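/- Let $K$ be a field, let $n\ge 0$, let $A=(a_{i,j})_{1\le i,j\le n}$ be an $n\times n$ matrix over $K$, and let $\lambda=(\lambda_a)_{a\in\mathbb Z}$, $\mu=(\mu_a)_{a\in\mathbb Z}$ be sequences in $K$. Let $s$ be the shift $(s\lambda)_a=\lambda_{a+1}$, with inverse $(s^{-1}\lambda)_a=\lambda_{a-1}$, and let $A_{i_1,\dots,i_k}^{j_1,\dots,j_k}$ be the matrix obtained from $A$ by erasing rows $i_1,\dots,i_k$ and columns $j_1,\dots,j_k$. The generalized Lambda-determinant $|A|_{\lambda,\mu}$ is defined inductively on the size: it is $1$ for the $0\times 0$ matrix, $a$ for the $1\times1$ matrix $(a)$, and for $n\ge 2$ $$|A|_{\lambda,\mu}=\frac{\mu_0\,|A_1^1|_{\lambda,s\mu}\,|A_n^n|_{\lambda,s^{-1}\mu}+\lambda_0\,|A_1^n|_{s^{-1}\lambda,\mu}\,|A_n^1|_{s\lambda,\mu}}{|A_{1,n}^{1,n}|_{\lambda,\mu}}.$$ The definition makes sense for $(A,\lambda,\mu)$ if no denominator occurring in this recursion, at any depth, is zero. An alternating sign matrix (ASM) is a square matrix with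 entries in $\{0,1,-1\}$ such that every row and every column has sum $1$ and its nonzero entries alternate in sign. For an $n\times n$ ASM $B=(b_{i,j})$ and an integer $a$, let $I_a(B)$ be the number of zero entries $b_{i,j}$ with $j-i=a$ such that the first nonzero entry to the right of $b_{i,j}$ in its row and the first nonzero entry below it in its column both exist and equal $1$; let $I'_a(B)$ be the number of zero entries $b_{i,j}$ with $i+j-n-1=a$ such that the first nonzero entry to the right in the row and the first nonzero entry above in the column both exist and equal $1$. Put $$F(A,\lambda,\mu)=\sum_{B\ n\times n\ \mathrm{ASM}}\ \prod_{a=2-n}^{n-2}\lambda_a^{I_a(B)}\mu_a^{I'_a(B)}\ \prod_{i,j=1}^n a_{i,j}^{b_{i,j}}\,(\lambda_{j-i}+\mu_{i+j-n-1})^{\delta_{b_{i,j},-1}}.$$ Theorem. (1) Whenever the definition of $|A|_{\lambda,\mu}$ makes sense, $|A|_{\lambda,\mu}=F(A,\lambda,\mu)$. (2) The definition makes sense when all $a_{i,j}$, $\lambda_a$, $\mu_a$ are independent indeterminates over $K$, and then $|A|_{\lambda,\mu}=F(A,\lambda,\mu)$ as rational functions. (3) The rational function $|A|_{\lambda,\mu}$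 of (2) is regular at every point $(A,\lambda,\mu)$ over $K$ with $a_{i,j}\neq 0$ for all $2\le i,j\le n-1$, and its value there is $F(A,\lambda,\mu)$. -/

import Mathlib

namespace LambdaDet

/-- The shift operator on sequences: `(s x)_a = x_{a+1}`. -/
def shift {K : Type*} (x : ℤ → K) : ℤ → K := fun a => x (a + 1)

/-- The inverse shift operator on sequences: `(s⁻¹ x)_a = x_{a-1}`. -/
def unshift {K : Type*} (x : ℤ → K) : ℤ → K := fun a => x (a - 1)

/-- Erase the first row and the first column. -/
def eraseFF {K : Type*} {n : ℕ} (A : Matrix (Fin (n + 1)) (Fin (n + 1)) K) :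
    Matrix (Fin n) (Fin n) K := A.submatrix Fin.succ Fin.succ

/-- Erase the last row and the last column. -/
def eraseLL {K : Type*} {n : ℕ} (A : Matrix (Fin (n + 1)) (Fin (n + 1)) K) :
    Matrix (Fin n) (Fin n) K := A.submatrix Fin.castSucc Fin.castSucc

/-- Erase the first row and the last column. -/
def eraseFL {K : Type*} {n : ℕ} (A : Matrix (Fin (n + 1)) (Fin (n + 1)) K) :
    Matrix (Fin n) (Fin n) K := A.submatrix Fin.succ Fin.castSucc

/-- Erase the last row and the first column. -/
def eraseLF {K : Type*} {n : ℕ} (A : Matrix (Fin (n + 1)) (Fin (n + 1)) K) :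
    Matrix (Fin n) (Fin n) K := A.submatrix Fin.castSucc Fin.succ

/-- The generalized Lambda-determinant, by the modified Dodgson condensation. -/
def lambdaDet {K : Type*} [Field K] :
    (n : ℕ) → Matrix (Fin n) (Fin n) K → (ℤ → K) → (ℤ → K) → K
  | 0, _, _, _ => 1
  | 1, A, _, _ => A 0 0
  | n + 2, A, l, m =>
      (m 0 * lambdaDet (n + 1) (eraseFF A) l (shift m)
            * lambdaDet (n + 1) (eraseLL A) l (unshift m)
        + l 0 * lambdaDet (n + 1) (eraseFL A) (unshift l) m
            * lambdaDet (n + 1) (eraseLF A) (shift l) m)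
        / lambdaDet n (eraseLL (eraseFF A)) l m

/-- The recursion defining `lambdaDet n A l m` makes sense: no denominator that occurs in it, at
any depth, vanishes. -/
def IsDefined {K : Type*} [Field K] :
    (n : ℕ) → Matrix (Fin n) (Fin n) K → (ℤ → K) → (ℤ → K) → Prop
  | 0, _, _, _ => True
  | 1, _, _, _ => True
  | n + 2, A, l, m =>
      IsDefined (n + 1) (eraseFF A) l (shift m) ∧
      IsDefined (n + 1) (eraseLL A) l (unshift m) ∧
      IsDefined (n + 1) (eraseFL A) (unshift l) m ∧
      IsDefined (n + 1) (eraseLF A) (shift l) m ∧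
      IsDefined n (eraseLL (eraseFF A)) l m ∧
      lambdaDet n (eraseLL (eraseFF A)) l m ≠ 0

/-- Alternating sign matrices: entries in `{0, 1, -1}` (built into `SignType`), every row and every
column sums to `1`, and its partial sums lie in `{0, 1}` (that is, its nonzero entries alternate in
sign, starting with `1`). -/
def IsASM {n : ℕ} (B : Matrix (Fin n) (Fin n) SignType) : Prop :=
  (∀ i, ∑ j, (B i j : ℤ) = 1) ∧
  (∀ j, ∑ i, (B i j : ℤ) = 1) ∧
  (∀ i k, 0 ≤ ∑ j ∈ Finset.univ.filter (· ≤ k), (B i j : ℤ) ∧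
    ∑ j ∈ Finset.univ.filter (· ≤ k), (B i j : ℤ) ≤ 1) ∧
  (∀ j k, 0 ≤ ∑ i ∈ Finset.univ.filter (· ≤ k), (B i j : ℤ) ∧
    ∑ i ∈ Finset.univ.filter (· ≤ k), (B i j : ℤ) ≤ 1)

instance {n : ℕ} : DecidablePred (IsASM (n := n)) := fun B => by
  unfold IsASM; infer_instance

/-- The first nonzero entry strictly to the right of `(i, j)` exists and is `1`. -/
def RightIsOne {n : ℕ} (B : Matrix (Fin n) (Fin n) SignType) (i j : Fin n) : Prop :=
  ∃ k, j < k ∧ B i k = 1 ∧ ∀ k', j < k' → k' < k → B i k' = 0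

/-- The first nonzero entry strictly below `(i, j)` exists and is `1`. -/
def BelowIsOne {n : ℕ} (B : Matrix (Fin n) (Fin n) SignType) (i j : Fin n) : Prop :=
  ∃ k, i < k ∧ B k j = 1 ∧ ∀ k', i < k' → k' < k → B k' j = 0

/-- The first nonzero entry strictly above `(i, j)` (going up) exists and is `1`. -/
def AboveIsOne {n : ℕ} (B : Matrix (Fin n) (Fin n) SignType) (i j : Fin n) : Prop :=
  ∃ k, k < i ∧ B k j = 1 ∧ ∀ k', k < k' → k' < i → B k' j = 0

instance {n : ℕ} (B : Matrix (Fin n) (Fin n) SignType) (i j : Fin n) :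
    Decidable (RightIsOne B i j) := by unfold RightIsOne; infer_instance

instance {n : ℕ} (B : Matrix (Fin n) (Fin n) SignType) (i j : Fin n) :
    Decidable (BelowIsOne B i j) := by unfold BelowIsOne; infer_instance

instance {n : ℕ} (B : Matrix (Fin n) (Fin n) SignType) (i j : Fin n) :
    Decidable (AboveIsOne B i j) := by unfold AboveIsOne; infer_instance

/-- The index `j - i` of the diagonal through `(i, j)`. -/
def diagIdx {n : ℕ} (i j : Fin n) : ℤ := (j : ℤ) - (i : ℤ)

/-- The index `i + j - n - 1` of the antidiagonal through `(i, j)`, for rows and columns numbered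
from `1`; elements of `Fin n` are numbered from `0`. -/
def antiIdx {n : ℕ} (i j : Fin n) : ℤ := ((i : ℤ) + 1) + ((j : ℤ) + 1) - (n : ℤ) - 1

/-- `I_a(B)`: the number of zero entries on the diagonal `a` whose first nonzero entries to the
right and below are both `1`. -/
def diagCount {n : ℕ} (B : Matrix (Fin n) (Fin n) SignType) (a : ℤ) : ℕ :=
  (Finset.univ.filter fun p : Fin n × Fin n =>
    diagIdx p.1 p.2 = a ∧ B p.1 p.2 = 0 ∧ RightIsOne B p.1 p.2 ∧ BelowIsOne B p.1 p.2).card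

/-- `I'_a(B)`: the number of zero entries on the antidiagonal `a` whose first nonzero entries to
the right and above are both `1`. -/
def antiCount {n : ℕ} (B : Matrix (Fin n) (Fin n) SignType) (a : ℤ) : ℕ :=
  (Finset.univ.filter fun p : Fin n × Fin n =>
    antiIdx p.1 p.2 = a ∧ B p.1 p.2 = 0 ∧ RightIsOne B p.1 p.2 ∧ AboveIsOne B p.1 p.2).card

/-- The sum over alternating sign matrices. -/
noncomputable def asmSum {K : Type*} [Field K] {n : ℕ} (A : Matrix (Fin n) (Fin n) K) (l m : ℤ → K) : K :=
  ∑ B ∈ Finset.univ.filter (IsASM (n := n)),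
    (∏ a ∈ Finset.Icc (2 - (n : ℤ)) ((n : ℤ) - 2), (l a ^ diagCount B a * m a ^ antiCount B a)) *
      ∏ i, ∏ j, (A i j ^ (B i j : ℤ) *
        (l (diagIdx i j) + m (antiIdx i j)) ^ (if B i j = -1 then 1 else 0 : ℕ))

/-- Names of the indeterminates: the matrix entries, the `λ_a` and the `μ_a`. -/
abbrev Vars (n : ℕ) : Type := (Fin n × Fin n) ⊕ (ℤ ⊕ ℤ)

/-- The field of rational functions in all these indeterminates. -/
abbrev RatFun (K : Type*) [Field K] (n : ℕ) : Type _ := FractionRing (MvPolynomial (Vars n) K)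

/-- An indeterminate, as a rational function. -/
noncomputable def var (K : Type*) [Field K] (n : ℕ) (v : Vars n) : RatFun K n :=
  algebraMap (MvPolynomial (Vars n) K) (RatFun K n) (MvPolynomial.X v)

/-- The matrix of indeterminates. -/
noncomputable def genMatrix (K : Type*) [Field K] (n : ℕ) : Matrix (Fin n) (Fin n) (RatFun K n) :=
  fun i j => var K n (Sum.inl (i, j))

/-- The sequence of indeterminates `λ_a`. -/
noncomputable def genLambda (K : Type*) [Field K] (n : ℕ) : ℤ → RatFun K n :=
  fun a => var K n (Sum.inr (Sum.inl a))

/-- The sequence of indeterminates `μ_a`. -/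
noncomputable def genMu (K : Type*) [Field K] (n : ℕ) : ℤ → RatFun K n :=
  fun a => var K n (Sum.inr (Sum.inr a))

/-- The assignment of values to the indeterminates given by `A`, `l`, `m`. -/
def point {K : Type*} {n : ℕ} (A : Matrix (Fin n) (Fin n) K) (l m : ℤ → K) : Vars n → K :=
  Sum.elim (fun p => A p.1 p.2) (Sum.elim l m)

/-- The rational function `r` is regular at the point `x`, with value `v` there. -/
def HasValueAt {K : Type*} [Field K] {n : ℕ} (r : RatFun K n) (x : Vars n → K) (v : K) : Prop :=
  ∃ P Q : MvPolynomial (Vars n) K, MvPolynomial.eval x Q ≠ 0 ∧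
    r = algebraMap (MvPolynomial (Vars n) K) (RatFun K n) P /
      algebraMap (MvPolynomial (Vars n) K) (RatFun K n) Q ∧
    v = MvPolynomial.eval x P / MvPolynomial.eval x Q

end LambdaDet

namespace LambdaDet

open Finset

/-! An alternating sign matrix is the array of mixed second differences of its corner sums, and
corner sum arrays of consecutive sizes interlace. Let `T k i j` be the determinant of the contiguous
`k × k` block at `(i, j)`. After the shifts of the parameters are absorbed into the position of the
block, the definition becomes a recurrence relating levels `k`, `k + 1`, `k + 2`. The invariant
carried through it is `pairSum`, a sum over interlacing pairs `(c, y)` in which the entries of level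
`k + 1` have exponents `cell c` and those of level `k` have exponents `-cell y`.

The step from one level to the next fixes the middle array `c` of a triple `z`, `c`, `y`.
Interlacing with `c` imposes an independent condition at each cell of `c`, so the sum over `y` and
the sum over `z` both factor into sums over cells. The local sums agree by the recurrence
(`cell_sum_identity`), and summation by parts (`exists_prod_zpow_cell_eq`) matches the monomials.
Hence `pairSum` is constant along the condensation (`pairSum_succ`). At the bottom level `T 0 = 1`,
so `y` can be summed out cell by cell. This leaves `l + m` at the entries `-1` and the inversion
weights at the zeros (`condensation_eq_sum_cornerSums`), which is the sum over alternating sign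
matrices.

The recurrence needs nonzero denominators, so the identity is proved for indeterminates. They are
nonzero there because all blocks take the value `1` at the point with entries `1`, `λ = 0`, `μ = 1`.
The formula inverts only interior entries, since `-1` never lies on the border; this gives
regularity. Where the recursion makes sense, these entries are nonzero, and both sides are the value
of one rational function (`HasValueAt.unique`). -/

/-! ### Corner sum arrays and interlacing. -/

/-- The mixed second difference of an array at the cell with upper left corner `(i, j)`. -/
def cell (c : ℕ → ℕ → ℤ) (i j : ℕ) : ℤ := c (i + 1) (j + 1) + c i j - c i (j + 1) - c (i + 1) j

/-- The boundary values shared by all corner sum arrays of `N × N` alternating sign matrices. -/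
structure HasBoundary (N : ℕ) (c : ℕ → ℕ → ℤ) : Prop where
  left : ∀ i ≤ N, c i 0 = 0
  top : ∀ j ≤ N, c 0 j = 0
  bottom : ∀ j ≤ N, c N j = j
  right : ∀ i ≤ N, c i N = i

/-- Corner sum arrays of `N × N` alternating sign matrices. -/
structure IsCornerSum (N : ℕ) (c : ℕ → ℕ → ℤ) : Prop extends HasBoundary N c where
  row : ∀ i ≤ N, ∀ j < N, c i j ≤ c i (j + 1) ∧ c i (j + 1) ≤ c i j + 1
  col : ∀ i < N, ∀ j ≤ N, c i j ≤ c (i + 1) j ∧ c (i + 1) j ≤ c i j + 1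

/-- The array `y`, placed on the cells of the `N × N` array `c`, interlaces with `c`. -/
def Interlace (N : ℕ) (c y : ℕ → ℕ → ℤ) : Prop :=
  ∀ i < N, ∀ j < N, c i j ≤ y i j ∧ c (i + 1) (j + 1) ≤ y i j + 1 ∧
    y i j ≤ c i (j + 1) ∧ y i j ≤ c (i + 1) j

/-- Neighbouring entries of `y` are compared through the entries of `c` between them: `y i j ≤ c i
(j + 1) ≤ y i (j + 1)` and `y i (j + 1) ≤ c (i + 1) (j + 1) ≤ y i j + 1`, and likewise for columns.
Interlacing therefore leaves no further condition linking different cells. -/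
theorem Interlace.isCornerSum_inner {N : ℕ} {c y : ℕ → ℕ → ℤ} (hc : HasBoundary (N + 1) c)
    (h : Interlace (N + 1) c y) : IsCornerSum N y where
  left i hi := by
    have := h i (by omega) 0 (by omega)
    have := hc.left i (by omega)
    have := hc.left (i + 1) (by omega)
    omega
  top j hj := by
    have := h 0 (by omega) j (by omega)
    have := hc.top j (by omega)
    have := hc.top (j + 1) (by omega)
    omega
  bottom j hj := by
    have := h N (by omega) j (by omega)
    have := hc.bottom j (by omega)
    have := hc.bottom (j + 1) (by omega)
    push_cast at *
    omega
  right i hi := by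
    have := h i (by omega) N (by omega)
    have := hc.right i (by omega)
    have := hc.right (i + 1) (by omega)
    push_cast at *
    omega
  row i hi j hj := by
    have := h i (by omega) j (by omega)
    have := h i (by omega) (j + 1) (by omega)
    omega
  col i hi j hj := by
    have := h i (by omega) j (by omega)
    have := h (i + 1) (by omega) j (by omega)
    omega

/-- The same sandwich works outward, for instance `z i j ≤ c i j ≤ z i (j + 1)`. Where the
sandwiching entry of `c` does not exist, the prescribed border of `z` gives the inequality. -/
theorem Interlace.isCornerSum_outer {N : ℕ} {z c : ℕ → ℕ → ℤ} (hz : HasBoundary N z)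
    (h : Interlace N z c) : IsCornerSum N z where
  toHasBoundary := hz
  row i hi j hj := by
    constructor
    · rcases hi.lt_or_eq with hi | rfl
      · have := h i hi j hj
        omega
      · rw [hz.bottom j (by omega), hz.bottom (j + 1) (by omega)]
        push_cast
        omega
    · rcases i with _ | i
      · rw [hz.top j (by omega), hz.top (j + 1) (by omega)]
        omega
      · have := h i (by omega) j hj
        omega
  col i hi j hj := by
    constructor
    · rcases hj.lt_or_eq with hj | rfl
      · have := h i hi j hj
        omega
      · rw [hz.right i (by omega), hz.right (i + 1) (by omega)]
        push_cast
        omega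
    · rcases j with _ | j
      · rw [hz.left i (by omega), hz.left (i + 1) (by omega)]
        omega
      · have := h i hi j (by omega)
        omega

theorem IsCornerSum.nonneg {N : ℕ} {c : ℕ → ℕ → ℤ} (hc : IsCornerSum N c) {i j : ℕ} (hi : i ≤ N)
    (hj : j ≤ N) : 0 ≤ c i j := by
  induction j with
  | zero => exact (hc.left i hi).ge
  | succ j ih => exact (ih (by omega)).trans (hc.row i hi j (by omega)).1

theorem IsCornerSum.le {N : ℕ} {c : ℕ → ℕ → ℤ} (hc : IsCornerSum N c) {i j : ℕ} (hi : i ≤ N)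
    (hj : j ≤ N) : c i j ≤ j := by
  induction j with
  | zero => exact (hc.left i hi).le
  | succ j ih =>
    have := ih (by omega)
    have := (hc.row i hi j (by omega)).2
    push_cast
    omega

theorem finite_cornerSums (N : ℕ) :
    {c : ℕ → ℕ → ℤ | IsCornerSum N c ∧ ∀ i j, N < i ∨ N < j → c i j = 0}.Finite := by
  refine Set.Finite.of_injOn (f := fun c (p : Fin (N + 1) × Fin (N + 1)) => c p.1 p.2)
    (t := ↑(Fintype.piFinset fun _ : Fin (N + 1) × Fin (N + 1) => Icc (0 : ℤ) N)) ?_ ?_ (Finset.finite_toSet _)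
  · rintro c ⟨hc, -⟩
    simp only [mem_coe, Fintype.mem_piFinset, mem_Icc, Prod.forall]
    intro i j
    refine ⟨hc.nonneg (by omega) (by omega), (hc.le (i := i) (j := j) (by omega) (by omega)).trans ?_⟩
    exact_mod_cast (by omega : (j : ℕ) ≤ N)
  · rintro c ⟨-, hc⟩ d ⟨-, hd⟩ h
    funext i j
    by_cases hij : N < i ∨ N < j
    · rw [hc i j hij, hd i j hij]
    · exact congrFun h (⟨i, by omega⟩, ⟨j, by omega⟩)

/-- The corner sum arrays of `N × N` alternating sign matrices, extended by zero. -/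
noncomputable def cornerSums (N : ℕ) : Finset (ℕ → ℕ → ℤ) := (finite_cornerSums N).toFinset

theorem mem_cornerSums {N : ℕ} {c : ℕ → ℕ → ℤ} :
    c ∈ cornerSums N ↔ IsCornerSum N c ∧ ∀ i j, N < i ∨ N < j → c i j = 0 := by
  simp [cornerSums]

/-! ### Sums over interlacing arrays as products of local sums. -/

/-- A product of finite sums over the cells of a square is a sum over arrays that restrict
bijectively to choices of summands. -/
theorem prod_sum_eq_sum_prod_of_window {L : Type*} [CommSemiring L] (M o : ℕ)
    (U : Finset (ℕ → ℕ → ℤ)) (S : ℕ → ℕ → Finset ℤ) (f : ℕ → ℕ → ℤ → L)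
    (hmem : ∀ u ∈ U, ∀ i < M, ∀ j < M, u (i + o) (j + o) ∈ S i j)
    (hinj : ∀ u ∈ U, ∀ v ∈ U, (∀ i < M, ∀ j < M, u (i + o) (j + o) = v (i + o) (j + o)) → u = v)
    (hsurj : ∀ g : ℕ → ℕ → ℤ, (∀ i < M, ∀ j < M, g i j ∈ S i j) →
      ∃ u ∈ U, ∀ i < M, ∀ j < M, u (i + o) (j + o) = g i j) :
    ∏ i ∈ range M, ∏ j ∈ range M, ∑ t ∈ S i j, f i j t =
      ∑ u ∈ U, ∏ i ∈ range M, ∏ j ∈ range M, f i j (u (i + o) (j + o)) := by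
  have key (g : ℕ → ℕ → L) : ∏ i ∈ range M, ∏ j ∈ range M, g i j =
      ∏ p : Fin M × Fin M, g p.1 p.2 := by
    rw [Fintype.prod_prod_type, Finset.prod_range]
    exact Finset.prod_congr rfl fun i _ => Finset.prod_range _
  simp only [key]
  rw [Finset.prod_univ_sum]
  symm
  refine Finset.sum_bij (fun u _ p => u (p.1 + o) (p.2 + o)) ?_ ?_ ?_ ?_
  · intro u hu
    exact Fintype.mem_piFinset.2 fun p => hmem u hu _ p.1.2 _ p.2.2
  · intro u hu v hv h
    exact hinj u hu v hv fun i hi j hj => congrFun h (⟨i, hi⟩, ⟨j, hj⟩)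
  · intro g hg
    obtain ⟨u, hu, h⟩ := hsurj
      (fun i j => if h : i < M ∧ j < M then g (⟨i, h.1⟩, ⟨j, h.2⟩) else 0) (by
        intro i hi j hj
        rw [dif_pos ⟨hi, hj⟩]
        exact Fintype.mem_piFinset.1 hg (⟨i, hi⟩, ⟨j, hj⟩))
    refine ⟨u, hu, ?_⟩
    funext p
    rw [h _ p.1.2 _ p.2.2, dif_pos ⟨p.1.2, p.2.2⟩]
  · intro u _
    rfl

/-- The values allowed at the cell `(i, j)` for a smaller array interlacing with `c`. -/
noncomputable def innerRange (c : ℕ → ℕ → ℤ) (i j : ℕ) : Finset ℤ :=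
  Icc (max (c i j) (c (i + 1) (j + 1) - 1)) (min (c i (j + 1)) (c (i + 1) j))

/-- The values allowed at the cell `(i, j)` for a larger array interlacing with `c`. -/
noncomputable def outerRange (c : ℕ → ℕ → ℤ) (i j : ℕ) : Finset ℤ :=
  Icc (max (c i (j + 1)) (c (i + 1) j)) (min (c i j + 1) (c (i + 1) (j + 1)))

-- With `c` fixed, the entries of `y` can be chosen independently in the ranges of their cells: any
-- such choice interlaces, and is then automatically a corner sum array.
open scoped Classical in
theorem prod_sum_innerRange {L : Type*} [CommSemiring L] {N : ℕ} {c : ℕ → ℕ → ℤ}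
    (hc : HasBoundary (N + 1) c) (f : ℕ → ℕ → ℤ → L) :
    ∏ i ∈ range (N + 1), ∏ j ∈ range (N + 1), ∑ t ∈ innerRange c i j, f i j t =
      ∑ y ∈ cornerSums N with Interlace (N + 1) c y,
        ∏ i ∈ range (N + 1), ∏ j ∈ range (N + 1), f i j (y i j) := by
  refine prod_sum_eq_sum_prod_of_window (N + 1) 0 _ _ f ?_ ?_ ?_
  · intro y hy i hi j hj
    have := (mem_filter.1 hy).2 i hi j hj
    simp only [innerRange, mem_Icc, max_le_iff, le_min_iff, add_zero]
    omega
  · intro u hu v hv h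
    funext i j
    by_cases hij : N < i ∨ N < j
    · rw [(mem_cornerSums.1 (mem_filter.1 hu).1).2 i j hij,
        (mem_cornerSums.1 (mem_filter.1 hv).1).2 i j hij]
    · exact h i (by omega) j (by omega)
  · intro g hg
    have hI : Interlace (N + 1) c fun i j => if N < i ∨ N < j then 0 else g i j := by
      intro i hi j hj
      have := hg i hi j hj
      beta_reduce
      rw [if_neg (by omega)]
      simp only [innerRange, mem_Icc, max_le_iff, le_min_iff] at this
      omega
    refine ⟨_, mem_filter.2 ⟨mem_cornerSums.2 ⟨hI.isCornerSum_inner hc, ?_⟩, hI⟩, ?_⟩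
    · intro i j hij
      exact if_pos hij
    · intro i hi j hj
      exact if_neg (by omega)

/-- Extension of an array on the cells of an `(N + 1) × (N + 1)` array by the boundary values of
corner sums. -/
def addBoundary (N : ℕ) (g : ℕ → ℕ → ℤ) (i j : ℕ) : ℤ :=
  if N + 2 < i ∨ N + 2 < j then 0 else if i = N + 2 then j else if j = N + 2 then i else
    if i = 0 ∨ j = 0 then 0 else g (i - 1) (j - 1)

theorem hasBoundary_addBoundary (N : ℕ) (g : ℕ → ℕ → ℤ) :
    HasBoundary (N + 2) (addBoundary N g) := by
  constructor <;> intro i hi <;> unfold addBoundary <;> split_ifs <;> simp_all <;> omega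

-- The border of `z` is forced, and each inner entry `z (i + 1) (j + 1)` is constrained only by the
-- four corners of the cell `(i, j)` of `c`. The window is thus the interior of `z`, at offset 1.
open scoped Classical in
theorem prod_sum_outerRange {L : Type*} [CommSemiring L] {N : ℕ} {c : ℕ → ℕ → ℤ}
    (hc : IsCornerSum (N + 1) c) (f : ℕ → ℕ → ℤ → L) :
    ∏ i ∈ range (N + 1), ∏ j ∈ range (N + 1), ∑ t ∈ outerRange c i j, f i j t =
      ∑ z ∈ cornerSums (N + 2) with Interlace (N + 2) z c,
        ∏ i ∈ range (N + 1), ∏ j ∈ range (N + 1), f i j (z (i + 1) (j + 1)) := by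
  refine prod_sum_eq_sum_prod_of_window (N + 1) 1 _ _ f ?_ ?_ ?_
  · intro z hz i hi j hj
    have hI := (mem_filter.1 hz).2
    have h1 := hI i (by omega) j (by omega)
    have h2 := hI (i + 1) (by omega) (j + 1) (by omega)
    have h3 := hI i (by omega) (j + 1) (by omega)
    have h4 := hI (i + 1) (by omega) j (by omega)
    simp only [outerRange, mem_Icc, max_le_iff, le_min_iff]
    omega
  · intro u hu v hv h
    obtain ⟨hu, hu'⟩ := mem_cornerSums.1 (mem_filter.1 hu).1
    obtain ⟨hv, hv'⟩ := mem_cornerSums.1 (mem_filter.1 hv).1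
    funext i j
    by_cases hij : N + 2 < i ∨ N + 2 < j
    · rw [hu' i j hij, hv' i j hij]
    push Not at hij
    rcases Nat.eq_zero_or_pos i with rfl | hi
    · rw [hu.top j hij.2, hv.top j hij.2]
    rcases Nat.eq_zero_or_pos j with rfl | hj
    · rw [hu.left i hij.1, hv.left i hij.1]
    rcases hij.1.eq_or_lt with rfl | hi'
    · rw [hu.bottom j hij.2, hv.bottom j hij.2]
    rcases hij.2.eq_or_lt with rfl | hj'
    · rw [hu.right i hij.1, hv.right i hij.1]
    have := h (i - 1) (by omega) (j - 1) (by omega)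
    rwa [Nat.sub_add_cancel hi, Nat.sub_add_cancel hj] at this
  · intro g hg
    have hB := hasBoundary_addBoundary N g
    have hin (i j : ℕ) (hi : i < N + 1) (hj : j < N + 1) :
        addBoundary N g (i + 1) (j + 1) = g i j := by
      unfold addBoundary
      rw [if_neg (by omega), if_neg (by omega), if_neg (by omega), if_neg (by omega)]
      rfl
    have hgb (i j : ℕ) (hi : i < N + 1) (hj : j < N + 1) :
        c i (j + 1) ≤ addBoundary N g (i + 1) (j + 1) ∧
        c (i + 1) j ≤ addBoundary N g (i + 1) (j + 1) ∧
        addBoundary N g (i + 1) (j + 1) ≤ c i j + 1 ∧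
        addBoundary N g (i + 1) (j + 1) ≤ c (i + 1) (j + 1) := by
      have := hg i hi j hj
      rw [hin i j hi hj]
      simp only [outerRange, mem_Icc, max_le_iff, le_min_iff] at this
      omega
    -- Inequalities at inner entries of the extended array are `hgb`; at border entries they follow
    -- from the prescribed borders of both arrays.
    have hI : Interlace (N + 2) (addBoundary N g) c := by
      intro i hi j hj
      refine ⟨?_, ?_, ?_, ?_⟩
      · rcases i with _ | i
        · rw [hB.top j (by omega), hc.top j (by omega)]
        rcases j with _ | j
        · rw [hB.left _ (by omega), hc.left _ (by omega)]
        have := hgb i j (by omega) (by omega)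
        omega
      · rcases (by omega : i = N + 1 ∨ i < N + 1) with rfl | hi'
        · rw [hB.bottom _ (by omega), hc.bottom _ (by omega)]
          push_cast; omega
        rcases (by omega : j = N + 1 ∨ j < N + 1) with rfl | hj'
        · rw [hB.right _ (by omega), hc.right _ (by omega)]
          push_cast; omega
        have := hgb i j (by omega) (by omega)
        omega
      · rcases i with _ | i
        · rw [hB.top _ (by omega), hc.top j (by omega)]
        rcases (by omega : j = N + 1 ∨ j < N + 1) with rfl | hj'
        · rw [hB.right _ (by omega), hc.right _ (by omega)]
        have := hgb i j (by omega) (by omega)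
        omega
      · rcases j with _ | j
        · rw [hB.left _ (by omega), hc.left _ (by omega)]
        rcases (by omega : i = N + 1 ∨ i < N + 1) with rfl | hj'
        · rw [hB.bottom _ (by omega), hc.bottom _ (by omega)]
        have := hgb i j (by omega) (by omega)
        omega
    refine ⟨_, mem_filter.2 ⟨mem_cornerSums.2 ⟨hI.isCornerSum_outer hB, ?_⟩, hI⟩, ?_⟩
    · intro i j hij
      exact if_pos hij
    · intro i hi j hj
      exact hin i j hi hj

/-! ### Summation by parts and the identity at one cell. -/

section WindowProducts

variable {L : Type*} [CommGroupWithZero L] (M : ℕ) (t : ℕ → ℕ → L) (e : ℕ → ℕ → ℤ)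

/-- A cell has four corners. This lemma and its three companions move a product over one kind of
corner to the larger grid of vertices, with exponent 0 off the window, so that products over
different corners can be merged. -/
theorem prod_zpow_window_nw :
    ∏ i ∈ range M, ∏ j ∈ range M, t i j ^ e i j =
      ∏ i ∈ range (M + 1), ∏ j ∈ range (M + 1), t i j ^ (if i < M ∧ j < M then e i j else 0) := by
  simp only [prod_range_succ, lt_irrefl, and_false, false_and, if_false, zpow_zero, prod_const_one,
    mul_one]
  refine prod_congr rfl fun i hi => prod_congr rfl fun j hj => ?_
  rw [if_pos ⟨mem_range.1 hi, mem_range.1 hj⟩]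

theorem prod_zpow_window_se :
    ∏ i ∈ range M, ∏ j ∈ range M, t (i + 1) (j + 1) ^ e i j =
      ∏ i ∈ range (M + 1), ∏ j ∈ range (M + 1),
        t i j ^ (if 0 < i ∧ 0 < j then e (i - 1) (j - 1) else 0) := by
  simp [prod_range_succ']

theorem prod_zpow_window_ne :
    ∏ i ∈ range M, ∏ j ∈ range M, t i (j + 1) ^ e i j =
      ∏ i ∈ range (M + 1), ∏ j ∈ range (M + 1),
        t i j ^ (if i < M ∧ 0 < j then e i (j - 1) else 0) := by
  rw [prod_range_succ]
  simp only [prod_range_succ', lt_irrefl, and_false, false_and, if_false, zpow_zero, prod_const_one,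
    mul_one]
  refine prod_congr rfl fun i hi => prod_congr rfl fun j hj => ?_
  rw [if_pos ⟨mem_range.1 hi, by omega⟩]
  rfl

theorem prod_zpow_window_sw :
    ∏ i ∈ range M, ∏ j ∈ range M, t (i + 1) j ^ e i j =
      ∏ i ∈ range (M + 1), ∏ j ∈ range (M + 1),
        t i j ^ (if 0 < i ∧ j < M then e (i - 1) j else 0) := by
  rw [prod_range_succ']
  simp only [prod_range_succ, lt_irrefl, and_false, false_and, if_false, zpow_zero, prod_const_one,
    mul_one]
  refine prod_congr rfl fun i hi => prod_congr rfl fun j hj => ?_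
  rw [if_pos ⟨by omega, mem_range.1 hj⟩]
  rfl

end WindowProducts

/-- Summation by parts for the monomials attached to three consecutive corner sum arrays. -/
theorem prod_zpow_cell_mul_prod_zpow_cell {L : Type*} [CommGroupWithZero L] {N : ℕ}
    {t : ℕ → ℕ → L} (ht : ∀ i j, t i j ≠ 0) {z c y : ℕ → ℕ → ℤ} (hz : HasBoundary (N + 2) z)
    (hc : HasBoundary (N + 1) c) (hy : HasBoundary N y) :
    (∏ i ∈ range (N + 2), ∏ j ∈ range (N + 2), t i j ^ cell z i j) *
        ∏ i ∈ range N, ∏ j ∈ range N, t (i + 1) (j + 1) ^ cell y i j =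
      ∏ i ∈ range (N + 1), ∏ j ∈ range (N + 1),
        ((t i j * t (i + 1) (j + 1)) ^ (z (i + 1) (j + 1) + y i j - c i (j + 1) - c (i + 1) j) *
          (t i (j + 1) * t (i + 1) j) ^
            (c i j + c (i + 1) (j + 1) - z (i + 1) (j + 1) - y i j)) := by
  simp only [mul_zpow, prod_mul_distrib]
  -- All products are brought to the `(N + 2) × (N + 2)` grid, so that the exponents of each `t i j`
  -- can be compared. The product for `y` is enlarged twice, once on each side.
  rw [prod_zpow_window_se N t, prod_zpow_window_nw (N + 1) t, prod_zpow_window_nw (N + 1) t,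
    prod_zpow_window_se (N + 1) t, prod_zpow_window_ne (N + 1) t, prod_zpow_window_sw (N + 1) t]
  simp only [← prod_mul_distrib, ← zpow_add₀ (ht _ _)]
  refine prod_congr rfl fun i hi => prod_congr rfl fun j hj => ?_
  rw [mem_range] at hi hj
  congr 1
  obtain ⟨z1, z2, z3, z4⟩ := hz
  obtain ⟨c1, c2, c3, c4⟩ := hc
  obtain ⟨y1, y2, y3, y4⟩ := hy
  unfold cell
  -- There are nine cases, according to whether row and column are first, inner or last. At inner
  -- vertices the terms in `c` cancel; elsewhere the prescribed borders replace the missing windows.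
  rcases i with _ | i
  · rcases j with _ | j
    · simp
      grind
    · rcases (by omega : j < N ∨ j = N) with hj | rfl
      · simp [hj]
        grind
      · simp
        grind
  · rcases (by omega : i < N ∨ i = N) with hi | rfl
    · rcases j with _ | j
      · simp [hi]
        grind
      · rcases (by omega : j < N ∨ j = N) with hj | rfl
        · simp [hi, hj]
          grind
        · simp [hi]
          grind
    · rcases j with _ | j
      · simp
        grind
      · rcases (by omega : j < i ∨ j = i) with hj | rfl
        · simp [hj]
          grind
        · simp
          grind

/-- The local form of the condensation identity, at a single cell. -/
theorem cell_sum_identity {L : Type*} [Field L] {l m P Q D : L} (hl : l ≠ 0) (hm : m ≠ 0)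
    (hP : P ≠ 0) (hQ : Q ≠ 0) (hD : D ≠ 0) (h : D = m * P + l * Q) {c : ℕ → ℕ → ℤ} {i j : ℕ}
    (h1 : c i j ≤ c i (j + 1) ∧ c i (j + 1) ≤ c i j + 1)
    (h2 : c i j ≤ c (i + 1) j ∧ c (i + 1) j ≤ c i j + 1)
    (h3 : c (i + 1) j ≤ c (i + 1) (j + 1) ∧ c (i + 1) (j + 1) ≤ c (i + 1) j + 1)
    (h4 : c i (j + 1) ≤ c (i + 1) (j + 1) ∧ c (i + 1) (j + 1) ≤ c i (j + 1) + 1) :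
    ∑ y ∈ innerRange c i j, D ^ cell c i j * (l ^ (y + 1 - c (i + 1) (j + 1)) *
        m ^ (c i (j + 1) - y)) * (P ^ (c i (j + 1) + c (i + 1) j - y) *
          Q ^ (y - c i j - c (i + 1) (j + 1))) =
      ∑ z ∈ outerRange c i j, l ^ (c i j + 1 - z) * m ^ (z - c (i + 1) j) * (P ^ z * Q ^ (-z)) := by
  unfold innerRange outerRange cell
  generalize c (i + 1) (j + 1) = s at *
  generalize c i (j + 1) = e at *
  generalize c (i + 1) j = w at *
  generalize c i j = a at *
  have hI (b : ℤ) : Icc b (b + 1) = {b, b + 1} := by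
    ext x; simp only [mem_Icc, mem_insert, mem_singleton]; omega
  -- These are the six possible shapes of a cell. In the second, `cell` is `1` and `z` has two
  -- values; in the fifth, `cell` is `-1` and `y` has two values. Only these two use `h`; in the
  -- other four both ranges are singletons.
  rcases (by omega : (e = a ∧ w = a ∧ s = a) ∨ (e = a ∧ w = a ∧ s = a + 1) ∨
    (e = a ∧ w = a + 1 ∧ s = a + 1) ∨ (e = a + 1 ∧ w = a ∧ s = a + 1) ∨
    (e = a + 1 ∧ w = a + 1 ∧ s = a + 1) ∨ (e = a + 1 ∧ w = a + 1 ∧ s = a + 1 + 1)) with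
    ⟨he, hw, hs⟩ | ⟨he, hw, hs⟩ | ⟨he, hw, hs⟩ | ⟨he, hw, hs⟩ | ⟨he, hw, hs⟩ | ⟨he, hw, hs⟩ <;>
  subst e w s
  · simp [zpow_sub₀, hP, hQ, hl, hm, zpow_add₀]
    field_simp
    simp
  · simp [zpow_sub₀, hP, hQ, hl, hm, hI, zpow_add₀]
    field_simp
    rw [h]
    ring
  · simp [zpow_sub₀, hP, hQ, hl, hm, zpow_add₀]
    field_simp
  · simp [zpow_sub₀, hP, hQ, hl, hm, zpow_add₀]
    field_simp
  · simp [zpow_sub₀, hP, hQ, hl, hm, hI, zpow_add₀]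
    field_simp
    rw [h]
    ring
  · simp [zpow_sub₀, hP, hQ, hl, hm, zpow_add₀]
    field_simp
    rw [show a + 1 + 1 + a - (a + 1) - (a + 1) = 0 by ring, zpow_zero]

theorem exists_hasBoundary (N : ℕ) : ∃ c, HasBoundary N c := by
  refine ⟨fun i j => if i = N then j else if j = N then i else 0, ?_⟩
  constructor <;> intro i hi <;> simp <;> grind

/-- On the right of the summation by parts, `z` and `y` enter the exponents additively, so their
contributions separate. Freezing one array shows that the inverse monomial of `y` and the monomial
of `z` are products over the cells of `c` with a common factor `k` independent of both, which then
cancels when the two sums are compared. -/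
theorem exists_prod_zpow_cell_eq {L : Type*} [CommGroupWithZero L] {N : ℕ}
    {t : ℕ → ℕ → L} (ht : ∀ i j, t i j ≠ 0) {c : ℕ → ℕ → ℤ} (hc : HasBoundary (N + 1) c) :
    ∃ k : L,
      (∀ y, HasBoundary N y → ∏ i ∈ range N, ∏ j ∈ range N, t (i + 1) (j + 1) ^ (-cell y i j) =
        k * ∏ i ∈ range (N + 1), ∏ j ∈ range (N + 1),
          ((t i j * t (i + 1) (j + 1)) ^ (c i (j + 1) + c (i + 1) j - y i j) *
            (t i (j + 1) * t (i + 1) j) ^ (y i j - c i j - c (i + 1) (j + 1)))) ∧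
      ∀ z, HasBoundary (N + 2) z → ∏ i ∈ range (N + 2), ∏ j ∈ range (N + 2), t i j ^ cell z i j =
        k * ∏ i ∈ range (N + 1), ∏ j ∈ range (N + 1),
          ((t i j * t (i + 1) (j + 1)) ^ z (i + 1) (j + 1) *
            (t i (j + 1) * t (i + 1) j) ^ (-z (i + 1) (j + 1))) := by
  obtain ⟨z₀, hz₀⟩ := exists_hasBoundary (N + 2)
  obtain ⟨y₀, hy₀⟩ := exists_hasBoundary N
  have hP (i j) : t i j * t (i + 1) (j + 1) ≠ 0 := mul_ne_zero (ht _ _) (ht _ _)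
  have hQ (i j) : t i (j + 1) * t (i + 1) j ≠ 0 := mul_ne_zero (ht _ _) (ht _ _)
  have hne (y : ℕ → ℕ → ℤ) : ∏ i ∈ range N, ∏ j ∈ range N, t (i + 1) (j + 1) ^ cell y i j ≠ 0 :=
    prod_ne_zero_iff.2 fun i _ => prod_ne_zero_iff.2 fun j _ => zpow_ne_zero _ (ht _ _)
  have hy (y) (h : HasBoundary N y) :
      ∏ i ∈ range N, ∏ j ∈ range N, t (i + 1) (j + 1) ^ (-cell y i j) =
        ((∏ i ∈ range (N + 2), ∏ j ∈ range (N + 2), t i j ^ cell z₀ i j) *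
          ∏ i ∈ range (N + 1), ∏ j ∈ range (N + 1),
            ((t i j * t (i + 1) (j + 1)) ^ (-z₀ (i + 1) (j + 1)) *
              (t i (j + 1) * t (i + 1) j) ^ z₀ (i + 1) (j + 1))) *
        ∏ i ∈ range (N + 1), ∏ j ∈ range (N + 1),
          ((t i j * t (i + 1) (j + 1)) ^ (c i (j + 1) + c (i + 1) j - y i j) *
            (t i (j + 1) * t (i + 1) j) ^ (y i j - c i j - c (i + 1) (j + 1))) := by
    have key := prod_zpow_cell_mul_prod_zpow_cell ht hz₀ hc h
    have hZ : ∏ i ∈ range (N + 2), ∏ j ∈ range (N + 2), t i j ^ cell z₀ i j ≠ 0 :=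
      prod_ne_zero_iff.2 fun i _ => prod_ne_zero_iff.2 fun j _ => zpow_ne_zero _ (ht _ _)
    simp only [zpow_neg _ (cell y _ _), prod_inv_distrib]
    rw [← mul_inv_cancel_left₀ hZ (_⁻¹), ← mul_inv, key, mul_assoc]
    congr 1
    simp only [← prod_mul_distrib, ← prod_inv_distrib]
    refine prod_congr rfl fun i _ => prod_congr rfl fun j _ => ?_
    rw [mul_inv, ← zpow_neg, ← zpow_neg, mul_mul_mul_comm, ← zpow_add₀ (hP i j),
      ← zpow_add₀ (hQ i j)]
    congr 2 <;> ring
  -- The constant is the one read off from `z₀`; the auxiliary `y₀` transfers it to every other `z`.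
  refine ⟨_, hy, fun z hz => ?_⟩
  have key := prod_zpow_cell_mul_prod_zpow_cell ht hz hc hy₀
  rw [← mul_inv_cancel_right₀ (hne y₀)
    (∏ i ∈ range (N + 2), ∏ j ∈ range (N + 2), t i j ^ cell z i j), key, mul_comm]
  simp only [← prod_inv_distrib, ← zpow_neg]
  rw [hy y₀ hy₀, mul_assoc]
  congr 1
  simp only [← prod_mul_distrib]
  refine prod_congr rfl fun i _ => prod_congr rfl fun j _ => ?_
  rw [mul_mul_mul_comm, ← zpow_add₀ (hP i j), ← zpow_add₀ (hQ i j)]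
  congr 2 <;> ring

/-! ### Condensation of the pair sum. -/

/-- The generating function of interlacing pairs of corner sum arrays. -/
noncomputable def pairSum {L : Type*} [Field L] (N : ℕ) (a b l m : ℕ → ℕ → L) : L :=
  open scoped Classical in
  ∑ c ∈ cornerSums (N + 1), ∑ y ∈ cornerSums N with Interlace (N + 1) c y,
    (∏ i ∈ range (N + 1), ∏ j ∈ range (N + 1), a i j ^ cell c i j *
      (l i j ^ (y i j + 1 - c (i + 1) (j + 1)) * m i j ^ (c i (j + 1) - y i j))) *
    ∏ i ∈ range N, ∏ j ∈ range N, b (i + 1) (j + 1) ^ (-cell y i j)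

-- Both sides are the same constant `k` times a product over the cells of `c` of local sums, and
-- these agree cell by cell by `cell_sum_identity`.
open scoped Classical in
theorem sum_inner_eq_sum_outer {L : Type*} [Field L] {N : ℕ} {D b l m : ℕ → ℕ → L}
    (hD : ∀ i j, D i j ≠ 0) (hb : ∀ i j, b i j ≠ 0) (hl : ∀ i j, l i j ≠ 0)
    (hm : ∀ i j, m i j ≠ 0)
    (h : ∀ i j, D i j = m i j * (b i j * b (i + 1) (j + 1)) + l i j * (b i (j + 1) * b (i + 1) j))
    {c : ℕ → ℕ → ℤ} (hc : IsCornerSum (N + 1) c) :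
    ∑ y ∈ cornerSums N with Interlace (N + 1) c y,
      (∏ i ∈ range (N + 1), ∏ j ∈ range (N + 1), D i j ^ cell c i j *
        (l i j ^ (y i j + 1 - c (i + 1) (j + 1)) * m i j ^ (c i (j + 1) - y i j))) *
      ∏ i ∈ range N, ∏ j ∈ range N, b (i + 1) (j + 1) ^ (-cell y i j) =
    ∑ z ∈ cornerSums (N + 2) with Interlace (N + 2) z c,
      (∏ i ∈ range (N + 1), ∏ j ∈ range (N + 1),
        l i j ^ (c i j + 1 - z (i + 1) (j + 1)) * m i j ^ (z (i + 1) (j + 1) - c (i + 1) j)) *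
      ∏ i ∈ range (N + 2), ∏ j ∈ range (N + 2), b i j ^ cell z i j := by
  obtain ⟨k, hy, hz⟩ := exists_prod_zpow_cell_eq hb hc.toHasBoundary
  have e1 := prod_sum_innerRange hc.toHasBoundary fun i j y =>
    D i j ^ cell c i j * (l i j ^ (y + 1 - c (i + 1) (j + 1)) * m i j ^ (c i (j + 1) - y)) *
      ((b i j * b (i + 1) (j + 1)) ^ (c i (j + 1) + c (i + 1) j - y) *
        (b i (j + 1) * b (i + 1) j) ^ (y - c i j - c (i + 1) (j + 1)))
  have e2 := prod_sum_outerRange hc fun i j z =>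
    l i j ^ (c i j + 1 - z) * m i j ^ (z - c (i + 1) j) *
      ((b i j * b (i + 1) (j + 1)) ^ z * (b i (j + 1) * b (i + 1) j) ^ (-z))
  have e3 : ∀ i ∈ range (N + 1), ∀ j ∈ range (N + 1), _ := fun i hi j hj =>
    have hi := mem_range.1 hi
    have hj := mem_range.1 hj
    cell_sum_identity (hl i j) (hm i j) (mul_ne_zero (hb i j) (hb (i + 1) (j + 1)))
      (mul_ne_zero (hb i (j + 1)) (hb (i + 1) j)) (hD i j) (h i j)
      (hc.row i (by omega) j hj) (hc.col i hi j (by omega)) (hc.row (i + 1) (by omega) j hj)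
      (hc.col i hi (j + 1) (by omega))
  rw [prod_congr rfl fun i hi => prod_congr rfl fun j hj => e3 i hi j hj, e2] at e1
  calc
    _ = k * ∑ y ∈ cornerSums N with Interlace (N + 1) c y,
        ∏ i ∈ range (N + 1), ∏ j ∈ range (N + 1), (D i j ^ cell c i j *
        (l i j ^ (y i j + 1 - c (i + 1) (j + 1)) * m i j ^ (c i (j + 1) - y i j)) *
      ((b i j * b (i + 1) (j + 1)) ^ (c i (j + 1) + c (i + 1) j - y i j) *
        (b i (j + 1) * b (i + 1) j) ^ (y i j - c i j - c (i + 1) (j + 1)))) := by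
      rw [mul_sum]
      refine sum_congr rfl fun y h => ?_
      rw [hy y (mem_cornerSums.1 (mem_filter.1 h).1).1.toHasBoundary, mul_left_comm]
      simp only [prod_mul_distrib]
    _ = _ := by
      rw [← e1, mul_sum]
      refine sum_congr rfl fun z h => ?_
      rw [hz z (mem_cornerSums.1 (mem_filter.1 h).1).1.toHasBoundary, mul_left_comm]
      simp only [prod_mul_distrib]

/-- One step of condensation, for the generating function of interlacing pairs. -/
theorem pairSum_succ {L : Type*} [Field L] {N : ℕ} {a b d l m l' m' : ℕ → ℕ → L}
    (ha : ∀ i j, a i j ≠ 0) (hb : ∀ i j, b i j ≠ 0) (hd : ∀ i j, d i j ≠ 0)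
    (hl : ∀ i j, l i j ≠ 0) (hm : ∀ i j, m i j ≠ 0)
    (h : ∀ i j, a i j * d (i + 1) (j + 1) =
      m i j * (b i j * b (i + 1) (j + 1)) + l i j * (b i (j + 1) * b (i + 1) j))
    (hl' : ∀ i j, l' i j = l i j) (hm' : ∀ i j, m' (i + 1) j = m i j) :
    pairSum N a b l m = pairSum (N + 1) b d l' m' := by
  classical
  unfold pairSum
  calc
    _ = ∑ c ∈ cornerSums (N + 1), ∑ z ∈ cornerSums (N + 2) with Interlace (N + 2) z c,
      (∏ i ∈ range (N + 1), ∏ j ∈ range (N + 1), d (i + 1) (j + 1) ^ (-cell c i j)) *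
      ((∏ i ∈ range (N + 1), ∏ j ∈ range (N + 1),
        l i j ^ (c i j + 1 - z (i + 1) (j + 1)) * m i j ^ (z (i + 1) (j + 1) - c (i + 1) j)) *
      ∏ i ∈ range (N + 2), ∏ j ∈ range (N + 2), b i j ^ cell z i j) := by
      refine sum_congr rfl fun c hc => ?_
      -- Here `D i j = a i j * d (i + 1) (j + 1)`: extracting `d ^ (-cell c)` turns `a ^ cell c`
      -- into `D ^ cell c`.
      rw [← mul_sum, ← sum_inner_eq_sum_outer
        (fun i j => mul_ne_zero (ha i j) (hd (i + 1) (j + 1))) hb hl hm h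
        (mem_cornerSums.1 hc).1, mul_sum]
      refine sum_congr (by congr) fun y _ => ?_
      rw [← mul_assoc]
      congr 1
      simp only [← prod_mul_distrib]
      refine prod_congr rfl fun i _ => prod_congr rfl fun j _ => ?_
      have := zpow_ne_zero (cell c i j) (hd (i + 1) (j + 1))
      rw [mul_zpow, zpow_neg]
      field_simp
    _ = ∑ z ∈ cornerSums (N + 2), ∑ c ∈ cornerSums (N + 1) with Interlace (N + 2) z c,
      (∏ i ∈ range (N + 1), ∏ j ∈ range (N + 1), d (i + 1) (j + 1) ^ (-cell c i j)) *
      ((∏ i ∈ range (N + 1), ∏ j ∈ range (N + 1),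
        l i j ^ (c i j + 1 - z (i + 1) (j + 1)) * m i j ^ (z (i + 1) (j + 1) - c (i + 1) j)) *
      ∏ i ∈ range (N + 2), ∏ j ∈ range (N + 2), b i j ^ cell z i j) :=
      -- After the exchange `z` is the larger array of the pair and `c` the smaller one.
      sum_comm' fun c z => by simp only [mem_filter]; tauto
    _ = _ := by
      refine sum_congr rfl fun z hz => sum_congr (by congr) fun c hc => ?_
      have hz := (mem_cornerSums.1 hz).1
      have hc := (mem_cornerSums.1 (mem_filter.1 hc).1).1
      rw [mul_comm]
      congr 1
      simp only [prod_mul_distrib, ← hl', ← hm']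
      -- The weights pass from the cells of `c` to those of `z`, with `m` moving down one row. On
      -- the added cells the exponents required by `pairSum` vanish because of the borders.
      rw [prod_zpow_window_nw (N + 1) l', prod_zpow_window_sw (N + 1) m', mul_comm]
      congr 1
      simp only [← prod_mul_distrib]
      refine prod_congr rfl fun i hi => prod_congr rfl fun j hj => ?_
      rw [mem_range] at hi hj
      congr 2
      · split_ifs with hij
        · rfl
        · rcases (by omega : i = N + 1 ∨ j = N + 1) with rfl | rfl
          · rw [hc.bottom j (by omega), hz.bottom (j + 1) (by omega)]
            push_cast; ring
          · rw [hc.right i (by omega), hz.right (i + 1) (by omega)]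
            push_cast; ring
      · split_ifs with hij
        · rw [Nat.sub_add_cancel hij.1]
        · rcases (by omega : i = 0 ∨ j = N + 1) with rfl | rfl
          · rw [hc.top j (by omega), hz.top (j + 1) (by omega)]
            ring
          · rw [hc.right i (by omega), hz.right i (by omega)]
            ring

theorem pairSum_zero {L : Type*} [Field L] (a b l m : ℕ → ℕ → L) : pairSum 0 a b l m = a 0 0 := by
  classical
  have h0 : cornerSums 0 = {fun _ _ => 0} := by
    ext c
    rw [mem_cornerSums, mem_singleton]
    constructor
    · rintro ⟨hc, h⟩
      funext i j
      by_cases hij : 0 < i ∨ 0 < j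
      · exact h i j hij
      · obtain ⟨rfl, rfl⟩ : i = 0 ∧ j = 0 := by omega
        exact hc.left 0 le_rfl
    · rintro rfl
      exact ⟨⟨⟨by simp, by simp, by simp, by simp⟩, by simp, by simp⟩, by simp⟩
  have h1 : cornerSums 1 = {fun i j => if i = 1 ∧ j = 1 then 1 else 0} := by
    ext c
    rw [mem_cornerSums, mem_singleton]
    constructor
    · rintro ⟨hc, h⟩
      funext i j
      by_cases hij : 1 < i ∨ 1 < j
      · rw [h i j hij, if_neg (by omega)]
      · have h1 := hc.left 0
        have h2 := hc.left 1
        have h3 := hc.right 0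
        have h4 := hc.right 1
        obtain ⟨rfl | rfl, rfl | rfl⟩ : (i = 0 ∨ i = 1) ∧ (j = 0 ∨ j = 1) := by omega
        all_goals simp_all
    · rintro rfl
      refine ⟨⟨⟨?_, ?_, ?_, ?_⟩, ?_, ?_⟩, ?_⟩ <;> grind
  have hI : Interlace (0 + 1) (fun i j => if i = 1 ∧ j = 1 then 1 else 0) fun _ _ => 0 := by
    intro i hi j hj
    obtain ⟨rfl, rfl⟩ : i = 0 ∧ j = 0 := by omega
    simp
  rw [pairSum, h1, h0, sum_singleton, filter_singleton, if_pos hI]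
  simp [cell]

/-! ### Summing out the smaller array. -/

/-- The weight of a corner sum array at a cell. -/
noncomputable def cellWeight {L : Type*} [Field L] (l m : L) (c : ℕ → ℕ → ℤ) (i j : ℕ) : L :=
  (if cell c i j = 0 ∧ c (i + 1) (j + 1) - c i (j + 1) = 0 ∧ c (i + 1) (j + 1) - c (i + 1) j = 0
    then l else 1) *
  (if cell c i j = 0 ∧ c (i + 1) (j + 1) - c i (j + 1) = 0 ∧ c i (j + 1) - c i j = 1
    then m else 1) *
  (if cell c i j = -1 then l + m else 1)

/-- Two values of `y` are allowed exactly when `cell` is `-1`, and they contribute `l` and `m`.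
Otherwise `y` is forced and its exponents are 0 or 1, recording the two inversion conditions. -/
theorem sum_innerRange_eq_cellWeight {L : Type*} [Field L] {l m : L} {c : ℕ → ℕ → ℤ} {i j : ℕ}
    (h1 : c i j ≤ c i (j + 1) ∧ c i (j + 1) ≤ c i j + 1)
    (h2 : c i j ≤ c (i + 1) j ∧ c (i + 1) j ≤ c i j + 1)
    (h3 : c (i + 1) j ≤ c (i + 1) (j + 1) ∧ c (i + 1) (j + 1) ≤ c (i + 1) j + 1)
    (h4 : c i (j + 1) ≤ c (i + 1) (j + 1) ∧ c (i + 1) (j + 1) ≤ c i (j + 1) + 1) :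
    ∑ y ∈ innerRange c i j, l ^ (y + 1 - c (i + 1) (j + 1)) * m ^ (c i (j + 1) - y) =
      cellWeight l m c i j := by
  unfold innerRange cellWeight cell
  generalize c (i + 1) (j + 1) = s at *
  generalize c i (j + 1) = e at *
  generalize c (i + 1) j = w at *
  generalize c i j = a at *
  have hI (b : ℤ) : Icc b (b + 1) = {b, b + 1} := by
    ext x; simp only [mem_Icc, mem_insert, mem_singleton]; omega
  rcases (by omega : (e = a ∧ w = a ∧ s = a) ∨ (e = a ∧ w = a ∧ s = a + 1) ∨
    (e = a ∧ w = a + 1 ∧ s = a + 1) ∨ (e = a + 1 ∧ w = a ∧ s = a + 1) ∨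
    (e = a + 1 ∧ w = a + 1 ∧ s = a + 1) ∨ (e = a + 1 ∧ w = a + 1 ∧ s = a + 1 + 1)) with
    ⟨he, hw, hs⟩ | ⟨he, hw, hs⟩ | ⟨he, hw, hs⟩ | ⟨he, hw, hs⟩ | ⟨he, hw, hs⟩ | ⟨he, hw, hs⟩ <;>
  subst e w s
  · simp
  · simp
  · simp
  · simp
  · simp [hI, add_comm]
  · have : a + 1 + 1 + a - (a + 1) - (a + 1) = 0 := by ring
    simp [this]

/-- A solution of the condensation recurrence with nonvanishing values, in terms of corner sums. -/
theorem condensation_eq_sum_cornerSums {L : Type*} [Field L] (n : ℕ) (T : ℕ → ℕ → ℕ → L)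
    (l m : ℤ → L) (hT : ∀ k i j, T k i j ≠ 0) (hl : ∀ a, l a ≠ 0) (hm : ∀ a, m a ≠ 0)
    (hT0 : ∀ i j, T 0 i j = 1)
    (h : ∀ k N i j, k + N + 1 = n → T (k + 2) i j * T k (i + 1) (j + 1) =
      m ((i : ℤ) + j - N) * (T (k + 1) i j * T (k + 1) (i + 1) (j + 1)) +
        l ((j : ℤ) - i) * (T (k + 1) i (j + 1) * T (k + 1) (i + 1) j)) :
    T (n + 1) 0 0 = ∑ c ∈ cornerSums (n + 1), ∏ i ∈ range (n + 1), ∏ j ∈ range (n + 1),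
      T 1 i j ^ cell c i j * cellWeight (l ((j : ℤ) - i)) (m ((i : ℤ) + j - n)) c i j := by
  classical
  -- Induction on `N` starts at the top level `k = n`, where only one pair exists. The argument of
  -- `m` is compatible with `pairSum_succ`, since raising `i` and `N` together leaves `i + j - N`
  -- unchanged.
  have key : ∀ N k, k + N = n → pairSum N (T (k + 1)) (T k) (fun i j => l ((j : ℤ) - i))
      (fun i j => m ((i : ℤ) + j - N)) = T (n + 1) 0 0 := by
    intro N
    induction N with
    | zero =>
      rintro k rfl
      exact pairSum_zero _ _ _ _
    | succ N ih =>
      intro k hk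
      rw [← ih (k + 1) (by omega)]
      refine (pairSum_succ (hT _) (hT _) (hT _) (fun _ _ => hl _) (fun _ _ => hm _)
        (fun i j => h k N i j (by omega)) (fun _ _ => rfl) (fun i j => ?_)).symm
      congr 1
      push_cast
      ring
  rw [← key n 0 (by omega), pairSum]
  refine sum_congr rfl fun c hc => ?_
  have hc := (mem_cornerSums.1 hc).1
  -- At level 0 the monomial of `y` is trivial, so the remaining sum over `y` factors over the
  -- cells.
  have e := prod_sum_innerRange hc.toHasBoundary fun i j y => T 1 i j ^ cell c i j *
    (l ((j : ℤ) - i) ^ (y + 1 - c (i + 1) (j + 1)) * m ((i : ℤ) + j - n) ^ (c i (j + 1) - y))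
  simp only [hT0, one_zpow, prod_const_one, mul_one]
  refine Eq.trans ?_ (e.symm.trans ?_)
  · rfl
  · refine prod_congr rfl fun i hi => prod_congr rfl fun j hj => ?_
    rw [mem_range] at hi hj
    rw [← mul_sum, sum_innerRange_eq_cellWeight (hc.row i (by omega) j hj)
      (hc.col i hi j (by omega)) (hc.row (i + 1) (by omega) j hj) (hc.col i hi (j + 1) (by omega))]

/-! ### Alternating sign matrices as corner sum arrays. -/

section PartialSums

variable {n : ℕ} {e : ℕ → ℤ}

theorem sum_eq_of_zero_between {a b : ℕ} (hab : a ≤ b) (h : ∀ k, a ≤ k → k < b → e k = 0) :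
    ∑ k ∈ range b, e k = ∑ k ∈ range a, e k := by
  induction b, hab using Nat.le_induction with
  | base => rfl
  | succ b hab ih =>
    rw [sum_range_succ, h b hab (by omega), add_zero, ih fun k h1 h2 => h k h1 (by omega)]

/-- Since partial sums stay in `{0, 1}` and end at `1`, a partial sum `0` must eventually rise, and
the first nonzero entry it meets is `1`; from a partial sum `1` an entry `1` would overshoot. -/
theorem exists_next_one (h : ∀ k ≤ n, 0 ≤ ∑ i ∈ range k, e i ∧ ∑ i ∈ range k, e i ≤ 1)
    (hn : ∑ i ∈ range n, e i = 1) {j : ℕ} (hj : j ≤ n) :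
    (∃ k, j ≤ k ∧ k < n ∧ e k = 1 ∧ ∀ k', j ≤ k' → k' < k → e k' = 0) ↔
      ∑ i ∈ range j, e i = 0 := by
  constructor
  · rintro ⟨k, hjk, hk, h1, h0⟩
    have := (h (k + 1) (by omega)).2
    rw [sum_range_succ, sum_eq_of_zero_between hjk h0] at this
    have := (h j hj).1
    omega
  · induction hj using Nat.decreasingInduction with
    | self => omega
    | of_succ j hj ih =>
      intro hs
      have hb := h (j + 1) (by omega)
      rw [sum_range_succ, hs] at hb ih
      rcases (by omega : e j = 1 ∨ e j = 0) with h1 | h0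
      · exact ⟨j, le_rfl, hj, h1, fun k' _ _ => by omega⟩
      · obtain ⟨k, hjk, hk, h1, h2⟩ := ih (by omega)
        refine ⟨k, by omega, hk, h1, fun k' hk' hk'' => ?_⟩
        rcases hk'.eq_or_lt with rfl | hlt
        · exact h0
        · exact h2 k' hlt hk''

theorem exists_prev_one (h : ∀ k ≤ n, 0 ≤ ∑ i ∈ range k, e i ∧ ∑ i ∈ range k, e i ≤ 1)
    {j : ℕ} (hj : j ≤ n) :
    (∃ k, k < j ∧ e k = 1 ∧ ∀ k', k < k' → k' < j → e k' = 0) ↔ ∑ i ∈ range j, e i = 1 := by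
  constructor
  · rintro ⟨k, hk, h1, h0⟩
    have := sum_eq_of_zero_between (e := e) (a := k + 1) hk fun k' => h0 k'
    rw [sum_range_succ, h1] at this
    have := (h k (by omega)).1
    have := (h j hj).2
    omega
  · induction j with
    | zero => simp
    | succ j ih =>
      intro hs
      have hb := h j (by omega)
      rw [sum_range_succ] at hs
      rcases (by omega : e j = 1 ∨ e j = 0) with h1 | h0
      · exact ⟨j, by omega, h1, fun k' _ _ => by omega⟩
      · obtain ⟨k, hk, h1, h2⟩ := ih (by omega) (by omega)
        refine ⟨k, by omega, h1, fun k' hk' hk'' => ?_⟩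
        rcases (Nat.le_of_lt_succ hk'').eq_or_lt with rfl | hlt
        · exact h0
        · exact h2 k' hk' hlt

end PartialSums

/-- The entries of a sign matrix as integers, extended by zero. -/
def entry {n : ℕ} (B : Matrix (Fin n) (Fin n) SignType) (i j : ℕ) : ℤ :=
  if h : i < n ∧ j < n then (B ⟨i, h.1⟩ ⟨j, h.2⟩ : ℤ) else 0

theorem entry_coe {n : ℕ} (B : Matrix (Fin n) (Fin n) SignType) (i j : Fin n) :
    entry B i j = (B i j : ℤ) := by
  simp [entry]

theorem sum_filter_le_fin {n : ℕ} (e : ℕ → ℤ) (k : Fin n) :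
    ∑ j : Fin n with j ≤ k, e j = ∑ j ∈ range (k + 1), e j := by
  rw [sum_filter]
  have : ∀ j : Fin n, (if j ≤ k then e j else 0) = (fun j : ℕ => if j ≤ k then e j else 0) j :=
    fun j => rfl
  rw [sum_congr rfl fun j _ => this j,
    Fin.sum_univ_eq_sum_range (fun j : ℕ => if j ≤ k then e j else 0), ← sum_filter]
  refine sum_congr ?_ fun _ _ => rfl
  ext x
  simp only [mem_filter, mem_range]
  omega

theorem isASM_iff {n : ℕ} (B : Matrix (Fin n) (Fin n) SignType) :
    IsASM B ↔ (∀ i < n, ∑ j ∈ range n, entry B i j = 1) ∧ (∀ j < n, ∑ i ∈ range n, entry B i j = 1) ∧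
      (∀ i < n, ∀ k ≤ n, 0 ≤ ∑ j ∈ range k, entry B i j ∧ ∑ j ∈ range k, entry B i j ≤ 1) ∧
      ∀ j < n, ∀ k ≤ n, 0 ≤ ∑ i ∈ range k, entry B i j ∧ ∑ i ∈ range k, entry B i j ≤ 1 := by
  unfold IsASM
  have s1 (i : Fin n) := Fin.sum_univ_eq_sum_range (fun j => entry B i j) n
  have s2 (j : Fin n) := Fin.sum_univ_eq_sum_range (fun i => entry B i j) n
  have s3 (i k : Fin n) := sum_filter_le_fin (fun j => entry B i j) k
  have s4 (j k : Fin n) := sum_filter_le_fin (fun i => entry B i j) k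
  simp only [← entry_coe, s1, s2, s3, s4]
  have aux (P : ℕ → ℤ → Prop) (e : ℕ → ℕ → ℤ) (h0 : ∀ i, P i 0) :
      (∀ i k : Fin n, P i (∑ j ∈ range (k + 1), e i j)) ↔
        ∀ i < n, ∀ k ≤ n, P i (∑ j ∈ range k, e i j) := by
    constructor
    · intro h i hi k hk
      rcases k with _ | k
      · simpa using h0 i
      · exact h ⟨i, hi⟩ ⟨k, hk⟩
    · intro h i k
      exact h i i.2 _ k.2
  rw [aux (fun _ s => 0 ≤ s ∧ s ≤ 1) (fun i j => entry B i j) (by simp),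
    aux (fun _ s => 0 ≤ s ∧ s ≤ 1) (fun i j => entry B j i) (by simp), Fin.forall_iff, Fin.forall_iff]

/-- The corner sums of a sign matrix. -/
def cornerSum {n : ℕ} (B : Matrix (Fin n) (Fin n) SignType) (i j : ℕ) : ℤ :=
  if n < i ∨ n < j then 0 else ∑ i' ∈ range i, ∑ j' ∈ range j, entry B i' j'

theorem cornerSum_of_le {n : ℕ} (B : Matrix (Fin n) (Fin n) SignType) {i j : ℕ} (hi : i ≤ n)
    (hj : j ≤ n) : cornerSum B i j = ∑ i' ∈ range i, ∑ j' ∈ range j, entry B i' j' :=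
  if_neg (by omega)

theorem cornerSum_succ_row {n : ℕ} (B : Matrix (Fin n) (Fin n) SignType) {i j : ℕ} (hi : i < n)
    (hj : j ≤ n) : cornerSum B (i + 1) j - cornerSum B i j = ∑ j' ∈ range j, entry B i j' := by
  rw [cornerSum_of_le B hi hj, cornerSum_of_le B hi.le hj, sum_range_succ, add_sub_cancel_left]

theorem cornerSum_succ_col {n : ℕ} (B : Matrix (Fin n) (Fin n) SignType) {i j : ℕ} (hi : i ≤ n)
    (hj : j < n) : cornerSum B i (j + 1) - cornerSum B i j = ∑ i' ∈ range i, entry B i' j := by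
  rw [cornerSum_of_le B hi hj, cornerSum_of_le B hi hj.le, ← sum_sub_distrib]
  simp only [sum_range_succ, add_sub_cancel_left]

theorem cell_cornerSum {n : ℕ} (B : Matrix (Fin n) (Fin n) SignType) {i j : ℕ} (hi : i < n)
    (hj : j < n) : cell (cornerSum B) i j = entry B i j := by
  have h1 := cornerSum_succ_row B hi (Nat.succ_le_of_lt hj)
  have h2 := cornerSum_succ_row B hi hj.le
  rw [sum_range_succ] at h1
  unfold cell
  linarith

/-- A difference of corner sums in one direction is a partial sum of a single row or column, so the
conditions on partial sums become steps of size 0 or 1. -/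
theorem IsASM.cornerSum_mem {n : ℕ} {B : Matrix (Fin n) (Fin n) SignType} (hB : IsASM B) :
    cornerSum B ∈ cornerSums n := by
  obtain ⟨h1, h2, h3, h4⟩ := (isASM_iff B).1 hB
  refine mem_cornerSums.2 ⟨⟨⟨?_, ?_, ?_, ?_⟩, ?_, ?_⟩, fun i j hij => if_pos hij⟩
  · intro i hi
    simp [cornerSum_of_le B hi (Nat.zero_le n)]
  · intro j hj
    simp [cornerSum_of_le B (Nat.zero_le n) hj]
  · intro j hj
    rw [cornerSum_of_le B le_rfl hj, sum_comm,
      sum_congr rfl fun j' hj' => h2 j' ((mem_range.1 hj').trans_le hj)]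
    simp
  · intro i hi
    rw [cornerSum_of_le B hi le_rfl,
      sum_congr rfl fun i' hi' => h1 i' ((mem_range.1 hi').trans_le hi)]
    simp
  · intro i hi j hj
    have := cornerSum_succ_col B hi hj
    have := h4 j hj i hi
    omega
  · intro i hi j hj
    have := cornerSum_succ_row B hi hj
    have := h3 i hi j hj
    omega

/-- The sign matrix of the second differences of an array. -/
noncomputable def signMatrix (n : ℕ) (c : ℕ → ℕ → ℤ) : Matrix (Fin n) (Fin n) SignType :=
  fun i j => SignType.sign (cell c i j)

theorem coe_sign_of_abs_le_one {x : ℤ} (h1 : -1 ≤ x) (h2 : x ≤ 1) :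
    ((SignType.sign x : SignType) : ℤ) = x := by
  obtain rfl | rfl | rfl : x = -1 ∨ x = 0 ∨ x = 1 := by omega
  all_goals decide

theorem sign_coe_int (s : SignType) : SignType.sign (s : ℤ) = s := by
  cases s <;> decide

theorem IsCornerSum.entry_signMatrix {n : ℕ} {c : ℕ → ℕ → ℤ} (hc : IsCornerSum n c) {i j : ℕ}
    (hi : i < n) (hj : j < n) : entry (signMatrix n c) i j = cell c i j := by
  have h1 := hc.col i hi j hj.le
  have h2 := hc.col i hi (j + 1) hj
  rw [entry, dif_pos ⟨hi, hj⟩]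
  change ((SignType.sign (cell c i j) : SignType) : ℤ) = cell c i j
  exact coe_sign_of_abs_le_one (by unfold cell; omega) (by unfold cell; omega)

theorem IsCornerSum.sum_row {n : ℕ} {c : ℕ → ℕ → ℤ} (hc : IsCornerSum n c) {i j : ℕ}
    (hi : i < n) (hj : j ≤ n) :
    ∑ j' ∈ range j, entry (signMatrix n c) i j' = c (i + 1) j - c i j := by
  have : ∀ j' ∈ range j, entry (signMatrix n c) i j' =
      (fun j => c (i + 1) j - c i j) (j' + 1) - (fun j => c (i + 1) j - c i j) j' := by
    intro j' hj'
    rw [hc.entry_signMatrix hi ((mem_range.1 hj').trans_le hj), cell]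
    ring
  rw [sum_congr rfl this, sum_range_sub (fun j => c (i + 1) j - c i j), hc.left i hi.le, hc.left (i + 1) hi]
  ring

theorem IsCornerSum.sum_col {n : ℕ} {c : ℕ → ℕ → ℤ} (hc : IsCornerSum n c) {i j : ℕ}
    (hi : i ≤ n) (hj : j < n) :
    ∑ i' ∈ range i, entry (signMatrix n c) i' j = c i (j + 1) - c i j := by
  have : ∀ i' ∈ range i, entry (signMatrix n c) i' j =
      (fun i => c i (j + 1) - c i j) (i' + 1) - (fun i => c i (j + 1) - c i j) i' := by
    intro i' hi'
    rw [hc.entry_signMatrix ((mem_range.1 hi').trans_le hi) hj, cell]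
    ring
  rw [sum_congr rfl this, sum_range_sub (fun i => c i (j + 1) - c i j), hc.top j hj.le, hc.top (j + 1) hj]
  ring

theorem IsCornerSum.isASM_signMatrix {n : ℕ} {c : ℕ → ℕ → ℤ} (hc : IsCornerSum n c) :
    IsASM (signMatrix n c) := by
  refine (isASM_iff _).2 ⟨?_, ?_, ?_, ?_⟩
  · intro i hi
    rw [hc.sum_row hi le_rfl, hc.right i hi.le, hc.right (i + 1) hi]
    push_cast; ring
  · intro j hj
    rw [hc.sum_col le_rfl hj, hc.bottom j hj.le, hc.bottom (j + 1) hj]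
    push_cast; ring
  · intro i hi k hk
    rw [hc.sum_row hi hk]
    have := hc.col i hi k hk
    omega
  · intro j hj k hk
    rw [hc.sum_col hk hj]
    have := hc.row k hk j hj
    omega

theorem cornerSum_signMatrix {n : ℕ} {c : ℕ → ℕ → ℤ} (hc : c ∈ cornerSums n) :
    cornerSum (signMatrix n c) = c := by
  obtain ⟨hc, h0⟩ := mem_cornerSums.1 hc
  funext i j
  by_cases hij : n < i ∨ n < j
  · rw [h0 i j hij]
    exact if_pos hij
  · rw [cornerSum_of_le _ (by omega) (by omega),
      sum_congr rfl fun i' hi' => hc.sum_row (i := i') (j := j)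
        (by have := mem_range.1 hi'; omega) (by omega),
      sum_range_sub (fun i => c i j), hc.top j (by omega), sub_zero]

theorem signMatrix_cornerSum {n : ℕ} (B : Matrix (Fin n) (Fin n) SignType) :
    signMatrix n (cornerSum B) = B := by
  funext i j
  rw [signMatrix, cell_cornerSum B i.2 j.2, entry_coe, sign_coe_int]

/-! ### Inversion conditions and the sum over alternating sign matrices. -/

section FirstNonzero

variable {n : ℕ} {B : Matrix (Fin n) (Fin n) SignType}

theorem coe_signType_eq_one {s : SignType} : (s : ℤ) = 1 ↔ s = 1 := by cases s <;> decide

theorem coe_signType_eq_zero {s : SignType} : (s : ℤ) = 0 ↔ s = 0 := by cases s <;> decide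

theorem coe_signType_eq_neg_one {s : SignType} : (s : ℤ) = -1 ↔ s = -1 := by cases s <;> decide

theorem exists_fin_next_iff (b : Fin n → SignType) (e : ℕ → ℤ) (he : ∀ j : Fin n, e j = (b j : ℤ))
    (j : Fin n) : (∃ k, j < k ∧ b k = 1 ∧ ∀ k', j < k' → k' < k → b k' = 0) ↔
      ∃ k, (j : ℕ) + 1 ≤ k ∧ k < n ∧ e k = 1 ∧ ∀ k', (j : ℕ) + 1 ≤ k' → k' < k → e k' = 0 := by
  constructor
  · rintro ⟨k, hk, h1, h0⟩
    refine ⟨k, hk, k.2, by rw [he, coe_signType_eq_one, h1], fun k' hk' hk'' => ?_⟩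
    have := h0 ⟨k', hk''.trans k.2⟩ hk' hk''
    rw [← coe_signType_eq_zero, ← he] at this
    exact this
  · rintro ⟨k, hk, hkn, h1, h0⟩
    refine ⟨⟨k, hkn⟩, hk, ?_, fun k' hk' hk'' => ?_⟩
    · rw [← coe_signType_eq_one, ← he, ← h1]
    · rw [← coe_signType_eq_zero, ← he]
      exact h0 k' hk' hk''

theorem exists_fin_prev_iff (b : Fin n → SignType) (e : ℕ → ℤ) (he : ∀ j : Fin n, e j = (b j : ℤ))
    (j : Fin n) : (∃ k, k < j ∧ b k = 1 ∧ ∀ k', k < k' → k' < j → b k' = 0) ↔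
      ∃ k, k < (j : ℕ) ∧ e k = 1 ∧ ∀ k', k < k' → k' < (j : ℕ) → e k' = 0 := by
  constructor
  · rintro ⟨k, hk, h1, h0⟩
    refine ⟨k, hk, by rw [he, coe_signType_eq_one, h1], fun k' hk' hk'' => ?_⟩
    have := h0 ⟨k', hk''.trans j.2⟩ hk' hk''
    rw [← coe_signType_eq_zero, ← he] at this
    exact this
  · rintro ⟨k, hk, h1, h0⟩
    refine ⟨⟨k, hk.trans j.2⟩, hk, ?_, fun k' hk' hk'' => ?_⟩
    · rw [← coe_signType_eq_one, ← he, ← h1]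
    · rw [← coe_signType_eq_zero, ← he]
      exact h0 k' hk' hk''

/-- The difference is the sum of row `i` through column `j`, so `exists_next_one` applies from
column `j + 1` on. -/
theorem IsASM.rightIsOne_iff (hB : IsASM B) (i j : Fin n) :
    RightIsOne B i j ↔ cornerSum B (i + 1) (j + 1) - cornerSum B i (j + 1) = 0 := by
  obtain ⟨h1, -, h3, -⟩ := (isASM_iff B).1 hB
  rw [cornerSum_succ_row B i.2 j.2, ← exists_next_one (h3 i i.2) (h1 i i.2) j.2]
  exact exists_fin_next_iff (B i) (entry B i) (entry_coe B i) j

theorem IsASM.belowIsOne_iff (hB : IsASM B) (i j : Fin n) :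
    BelowIsOne B i j ↔ cornerSum B (i + 1) (j + 1) - cornerSum B (i + 1) j = 0 := by
  obtain ⟨-, h2, -, h4⟩ := (isASM_iff B).1 hB
  rw [cornerSum_succ_col B i.2 j.2,
    ← exists_next_one (e := fun i => entry B i j) (h4 j j.2) (h2 j j.2) i.2]
  exact exists_fin_next_iff (fun i => B i j) (fun i => entry B i j) (fun i => entry_coe B i j) i

theorem IsASM.aboveIsOne_iff (hB : IsASM B) (i j : Fin n) :
    AboveIsOne B i j ↔ cornerSum B i (j + 1) - cornerSum B i j = 1 := by
  obtain ⟨-, -, -, h4⟩ := (isASM_iff B).1 hB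
  rw [cornerSum_succ_col B i.2.le j.2,
    ← exists_prev_one (e := fun i => entry B i j) (h4 j j.2) i.2.le]
  exact exists_fin_prev_iff (fun i => B i j) (fun i => entry B i j) (fun i => entry_coe B i j) i

end FirstNonzero

theorem prod_pow_card_filter {L ι : Type*} [CommMonoid L] [Fintype ι] (f : ι → ℤ) (C : ι → Prop)
    [DecidablePred C] (s : Finset ℤ) (l : ℤ → L) (h : ∀ p, C p → f p ∈ s) :
    ∏ a ∈ s, l a ^ #{p | f p = a ∧ C p} = ∏ p, if C p then l (f p) else 1 := by
  have (a : ℤ) : l a ^ #{p | f p = a ∧ C p} = ∏ p, if f p = a then (if C p then l a else 1) else 1 := by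
    rw [← prod_const, prod_filter]
    exact prod_congr rfl fun p _ => ite_and _ _ _ _
  simp only [this]
  rw [prod_comm]
  refine prod_congr rfl fun p _ => ?_
  rw [prod_ite_eq]
  by_cases hC : C p
  · rw [if_pos (h p hC)]
  · simp [hC]

/-- Collecting the powers of `l a` and `m a` cell by cell makes the summand a product of local
factors, which the corner sum bijection identifies with `cellWeight`. -/
theorem asmSum_eq_sum_cornerSums {L : Type*} [Field L] {n : ℕ} (A : Matrix (Fin n) (Fin n) L)
    (A' : ℕ → ℕ → L) (hA : ∀ i j : Fin n, A' i j = A i j) (l m : ℤ → L) :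
    asmSum A l m = ∑ c ∈ cornerSums n, ∏ i ∈ range n, ∏ j ∈ range n, A' i j ^ cell c i j *
      cellWeight (l ((j : ℤ) - i)) (m ((i : ℤ) + j - n + 1)) c i j := by
  unfold asmSum
  refine sum_bij' (fun B _ => cornerSum B) (fun c _ => signMatrix n c)
    (fun B hB => (mem_filter.1 hB).2.cornerSum_mem)
    (fun c hc => mem_filter.2 ⟨mem_univ _, (mem_cornerSums.1 hc).1.isASM_signMatrix⟩)
    (fun B _ => signMatrix_cornerSum B) (fun c hc => cornerSum_signMatrix hc) ?_
  intro B hB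
  have hB := (mem_filter.1 hB).2
  rw [prod_mul_distrib]
  have hd : ∏ a ∈ Icc (2 - (n : ℤ)) (n - 2), l a ^ diagCount B a = ∏ i, ∏ j,
      if B i j = 0 ∧ RightIsOne B i j ∧ BelowIsOne B i j then l (diagIdx i j) else 1 := by
    rw [← Fintype.prod_prod_type' (f := fun i j =>
      if B i j = 0 ∧ RightIsOne B i j ∧ BelowIsOne B i j then l (diagIdx i j) else 1)]
    refine prod_pow_card_filter (fun p : Fin n × Fin n => diagIdx p.1 p.2)
      (fun p => B p.1 p.2 = 0 ∧ RightIsOne B p.1 p.2 ∧ BelowIsOne B p.1 p.2) _ l ?_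
    -- A counted cell is neither in the last column nor in the last row, so its diagonal index lies
    -- in the range of the product.
    rintro ⟨i, j⟩ ⟨-, ⟨k, hk, -⟩, k', hk', -⟩
    dsimp only at hk hk'
    simp only [diagIdx, mem_Icc]
    omega
  have ha : ∏ a ∈ Icc (2 - (n : ℤ)) (n - 2), m a ^ antiCount B a = ∏ i, ∏ j,
      if B i j = 0 ∧ RightIsOne B i j ∧ AboveIsOne B i j then m (antiIdx i j) else 1 := by
    rw [← Fintype.prod_prod_type' (f := fun i j =>
      if B i j = 0 ∧ RightIsOne B i j ∧ AboveIsOne B i j then m (antiIdx i j) else 1)]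
    refine prod_pow_card_filter (fun p : Fin n × Fin n => antiIdx p.1 p.2)
      (fun p => B p.1 p.2 = 0 ∧ RightIsOne B p.1 p.2 ∧ AboveIsOne B p.1 p.2) _ m ?_
    -- A counted cell is neither in the last column nor in the first row.
    rintro ⟨i, j⟩ ⟨-, ⟨k, hk, -⟩, k', hk', -⟩
    dsimp only at hk hk'
    simp only [antiIdx, mem_Icc]
    omega
  rw [hd, ha, prod_range]
  simp only [prod_range, ← prod_mul_distrib]
  refine prod_congr rfl fun i _ => prod_congr rfl fun j _ => ?_
  have e1 : antiIdx i j = (i : ℤ) + j - n + 1 := by unfold antiIdx; ring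
  rw [hA, cellWeight, cell_cornerSum B i.2 j.2, entry_coe]
  simp only [coe_signType_eq_zero, coe_signType_eq_neg_one, ← hB.rightIsOne_iff,
    ← hB.belowIsOne_iff, ← hB.aboveIsOne_iff, e1, diagIdx, pow_ite, pow_one, pow_zero]
  ring

/-! ### Values of rational functions at a point. -/

section HasValueAt

variable {K : Type*} [Field K] {N : ℕ} {x : Vars N → K} {r r' : RatFun K N} {v v' : K}

theorem algebraMap_ne_zero_of_eval_ne_zero {Q : MvPolynomial (Vars N) K}
    (hQ : MvPolynomial.eval x Q ≠ 0) : algebraMap (MvPolynomial (Vars N) K) (RatFun K N) Q ≠ 0 := by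
  intro h
  rw [map_eq_zero_iff _ (IsFractionRing.injective (MvPolynomial (Vars N) K) (RatFun K N))] at h
  exact hQ (by rw [h, map_zero])

theorem HasValueAt.algebraMap (P : MvPolynomial (Vars N) K) :
    HasValueAt (algebraMap _ (RatFun K N) P) x (MvPolynomial.eval x P) :=
  ⟨P, 1, by simp, by simp, by simp⟩

theorem HasValueAt.var (a : Vars N) : HasValueAt (var K N a) x (x a) := by
  have h := HasValueAt.algebraMap (x := x) (MvPolynomial.X a)
  rwa [MvPolynomial.eval_X] at h

theorem HasValueAt.one : HasValueAt (1 : RatFun K N) x 1 := by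
  simpa using HasValueAt.algebraMap (x := x) 1

theorem HasValueAt.zero : HasValueAt (0 : RatFun K N) x 0 := by
  simpa using HasValueAt.algebraMap (x := x) 0

theorem HasValueAt.add (h : HasValueAt r x v) (h' : HasValueAt r' x v') :
    HasValueAt (r + r') x (v + v') := by
  obtain ⟨P, Q, hQ, rfl, rfl⟩ := h
  obtain ⟨P', Q', hQ', rfl, rfl⟩ := h'
  refine ⟨P * Q' + Q * P', Q * Q', by simp [hQ, hQ'], ?_, ?_⟩
  · rw [div_add_div _ _ (algebraMap_ne_zero_of_eval_ne_zero hQ)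
      (algebraMap_ne_zero_of_eval_ne_zero hQ')]
    simp only [map_add, map_mul]
  · rw [div_add_div _ _ hQ hQ']
    simp only [map_add, map_mul]

theorem HasValueAt.mul (h : HasValueAt r x v) (h' : HasValueAt r' x v') :
    HasValueAt (r * r') x (v * v') := by
  obtain ⟨P, Q, hQ, rfl, rfl⟩ := h
  obtain ⟨P', Q', hQ', rfl, rfl⟩ := h'
  refine ⟨P * P', Q * Q', by simp [hQ, hQ'], ?_, ?_⟩ <;> rw [div_mul_div_comm] <;>
    simp only [map_mul]

theorem HasValueAt.inv (h : HasValueAt r x v) (hv : v ≠ 0) : HasValueAt r⁻¹ x v⁻¹ := by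
  obtain ⟨P, Q, hQ, rfl, rfl⟩ := h
  exact ⟨Q, P, fun h => hv (by simp [h]), inv_div _ _, inv_div _ _⟩

theorem HasValueAt.div (h : HasValueAt r x v) (h' : HasValueAt r' x v') (hv : v' ≠ 0) :
    HasValueAt (r / r') x (v / v') := by
  rw [div_eq_mul_inv, div_eq_mul_inv]
  exact h.mul (h'.inv hv)

theorem HasValueAt.ne_zero (h : HasValueAt r x v) (hv : v ≠ 0) : r ≠ 0 := by
  obtain ⟨P, Q, hQ, rfl, rfl⟩ := h
  exact div_ne_zero (algebraMap_ne_zero_of_eval_ne_zero (x := x) fun h => hv (by simp [h]))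
    (algebraMap_ne_zero_of_eval_ne_zero hQ)

/-- Cross multiplication gives an identity of polynomials, which can be evaluated at `x`. -/
theorem HasValueAt.unique (h : HasValueAt r x v) (h' : HasValueAt r x v') : v = v' := by
  obtain ⟨P, Q, hQ, rfl, rfl⟩ := h
  obtain ⟨P', Q', hQ', e, rfl⟩ := h'
  rw [div_eq_div_iff (algebraMap_ne_zero_of_eval_ne_zero hQ)
    (algebraMap_ne_zero_of_eval_ne_zero hQ'), ← map_mul, ← map_mul] at e
  have e := congrArg (MvPolynomial.eval x)
    (IsFractionRing.injective (MvPolynomial (Vars N) K) (RatFun K N) e)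
  rw [map_mul, map_mul] at e
  rwa [div_eq_div_iff hQ hQ']

theorem HasValueAt.sum {ι : Type*} {s : Finset ι} {f : ι → RatFun K N} {g : ι → K}
    (h : ∀ i ∈ s, HasValueAt (f i) x (g i)) : HasValueAt (∑ i ∈ s, f i) x (∑ i ∈ s, g i) := by
  classical
  induction s using Finset.induction_on with
  | empty => simpa using HasValueAt.zero
  | insert a s ha ih =>
    rw [sum_insert ha, sum_insert ha]
    exact (h a (mem_insert_self a s)).add (ih fun i hi => h i (mem_insert_of_mem hi))

theorem HasValueAt.prod {ι : Type*} {s : Finset ι} {f : ι → RatFun K N} {g : ι → K}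
    (h : ∀ i ∈ s, HasValueAt (f i) x (g i)) : HasValueAt (∏ i ∈ s, f i) x (∏ i ∈ s, g i) := by
  classical
  induction s using Finset.induction_on with
  | empty => simpa using HasValueAt.one
  | insert a s ha ih =>
    rw [prod_insert ha, prod_insert ha]
    exact (h a (mem_insert_self a s)).mul (ih fun i hi => h i (mem_insert_of_mem hi))

theorem HasValueAt.pow (h : HasValueAt r x v) (n : ℕ) : HasValueAt (r ^ n) x (v ^ n) := by
  simpa using HasValueAt.prod (s := range n) fun _ _ => h

theorem HasValueAt.zpow_sign (h : HasValueAt r x v) (s : SignType) (hs : s = -1 → v ≠ 0) :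
    HasValueAt (r ^ (s : ℤ)) x (v ^ (s : ℤ)) := by
  rcases s.trichotomy with rfl | rfl | rfl
  · simpa using h.inv (hs rfl)
  · simpa using HasValueAt.one
  · simpa using h

/-- The recursion defining the generalized Lambda-determinant is compatible with specialization,
as long as it makes sense at the special point. -/
theorem IsDefined.hasValueAt_lambdaDet : ∀ (n : ℕ) {M : Matrix (Fin n) (Fin n) (RatFun K N)}
    {L U : ℤ → RatFun K N} {A : Matrix (Fin n) (Fin n) K} {l m : ℤ → K},
    (∀ i j, HasValueAt (M i j) x (A i j)) → (∀ a, HasValueAt (L a) x (l a)) →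
    (∀ a, HasValueAt (U a) x (m a)) → IsDefined n A l m →
    IsDefined n M L U ∧ HasValueAt (lambdaDet n M L U) x (lambdaDet n A l m)
  | 0, _, _, _, _, _, _, _, _, _, _ => ⟨trivial, HasValueAt.one⟩
  | 1, _, _, _, _, _, _, hM, _, _, _ => ⟨trivial, hM 0 0⟩
  | n + 2, _, _, _, _, _, _, hM, hL, hU, h => by
    obtain ⟨h1, h2, h3, h4, h5, h6⟩ := h
    obtain ⟨d1, v1⟩ := IsDefined.hasValueAt_lambdaDet (n + 1)
      (fun i j => hM i.succ j.succ) hL (fun a => hU (a + 1)) h1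
    obtain ⟨d2, v2⟩ := IsDefined.hasValueAt_lambdaDet (n + 1)
      (fun i j => hM i.castSucc j.castSucc) hL (fun a => hU (a - 1)) h2
    obtain ⟨d3, v3⟩ := IsDefined.hasValueAt_lambdaDet (n + 1)
      (fun i j => hM i.succ j.castSucc) (fun a => hL (a - 1)) hU h3
    obtain ⟨d4, v4⟩ := IsDefined.hasValueAt_lambdaDet (n + 1)
      (fun i j => hM i.castSucc j.succ) (fun a => hL (a + 1)) hU h4
    obtain ⟨d5, v5⟩ := IsDefined.hasValueAt_lambdaDet n
      (fun i j => hM i.castSucc.succ j.castSucc.succ) hL hU h5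
    exact ⟨⟨d1, d2, d3, d4, d5, v5.ne_zero h6⟩,
      ((((hU 0).mul v1).mul v2).add (((hL 0).mul v3).mul v4)).div v5 h6⟩

end HasValueAt

/-! ### A point where no denominator vanishes. -/

section Ones

variable (K : Type*) [Field K]

/-- With `λ = 0` and `μ = 1` every block of ones has value `1` in every characteristic. With `λ = μ
= 1` the `2 × 2` block would have value `2`, which vanishes in characteristic two. -/
theorem isDefined_one : ∀ n : ℕ, IsDefined (K := K) n (fun _ _ => 1) (fun _ => 0) (fun _ => 1) ∧
    lambdaDet (K := K) n (fun _ _ => 1) (fun _ => 0) (fun _ => 1) = 1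
  | 0 => ⟨trivial, rfl⟩
  | 1 => ⟨trivial, rfl⟩
  | n + 2 => by
    obtain ⟨d1, v1⟩ := isDefined_one (n + 1)
    obtain ⟨d0, v0⟩ := isDefined_one n
    -- Constant matrices and sequences are unchanged by erasing and shifting, so the four minors
    -- coincide.
    refine ⟨⟨d1, d1, d1, d1, d0, v0.trans_ne one_ne_zero⟩, ?_⟩
    change (1 * lambdaDet (n + 1) (fun _ _ => 1) (fun _ => 0) (fun _ => 1) *
      lambdaDet (n + 1) (fun _ _ => 1) (fun _ => 0) (fun _ => 1) +
      0 * lambdaDet (n + 1) (fun _ _ => 1) (fun _ => 0) (fun _ => 1) *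
      lambdaDet (n + 1) (fun _ _ => 1) (fun _ => 0) (fun _ => 1)) /
      lambdaDet n (fun _ _ => (1 : K)) (fun _ => 0) (fun _ => 1) = 1
    rw [v1, v0]
    norm_num

end Ones

/-! ### Contiguous blocks and interior entries. -/

/-- The contiguous `k × k` block of an array with upper left corner `(i, j)`. -/
def block {L : Type*} (A : ℕ → ℕ → L) (k i j : ℕ) : Matrix (Fin k) (Fin k) L :=
  Matrix.of fun a b => A (i + a) (j + b)

/-- The generalized Lambda-determinant of the contiguous `k × k` block with upper left corner
`(i, j)`, with the shifts of the parameters that occur in the recursion for the size `n`. -/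
def blockDet {L : Type*} [Field L] (A : ℕ → ℕ → L) (l m : ℤ → L) (n k i j : ℕ) : L :=
  lambdaDet k (block A k i j) (fun a => l (a + ((j : ℤ) - i)))
    (fun a => m (a + ((i : ℤ) + j + k - n)))

section Block

variable {L : Type*} (A : ℕ → ℕ → L) (k i j : ℕ)

theorem eraseFF_block : eraseFF (block A (k + 1) i j) = block A k (i + 1) (j + 1) := by
  ext a b
  simp [eraseFF, block, add_comm, add_left_comm]

theorem eraseLL_block : eraseLL (block A (k + 1) i j) = block A k i j := by
  ext a b
  simp [eraseLL, block]

theorem eraseFL_block : eraseFL (block A (k + 1) i j) = block A k (i + 1) j := by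
  ext a b
  simp [eraseFL, block, add_comm, add_left_comm]

theorem eraseLF_block : eraseLF (block A (k + 1) i j) = block A k i (j + 1) := by
  ext a b
  simp [eraseLF, block, add_comm, add_left_comm]

end Block

theorem lambdaDet_add_two {L : Type*} [Field L] (n : ℕ) (A : Matrix (Fin (n + 2)) (Fin (n + 2)) L)
    (l m : ℤ → L) : lambdaDet (n + 2) A l m =
      (m 0 * lambdaDet (n + 1) (eraseFF A) l (shift m)
            * lambdaDet (n + 1) (eraseLL A) l (unshift m)
        + l 0 * lambdaDet (n + 1) (eraseFL A) (unshift l) m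
            * lambdaDet (n + 1) (eraseLF A) (shift l) m)
        / lambdaDet n (eraseLL (eraseFF A)) l m := rfl

/-- The accumulated shifts depend only on the size and position of the block, not on the order of
erasures, so the recursion closes up into a recurrence in `k`, `i`, `j`. -/
theorem blockDet_add_two {L : Type*} [Field L] (A : ℕ → ℕ → L) (l m : ℤ → L) (n k i j : ℕ) :
    blockDet A l m n (k + 2) i j =
      (m ((i : ℤ) + j + k + 2 - n) * blockDet A l m n (k + 1) (i + 1) (j + 1) *
          blockDet A l m n (k + 1) i j +
        l ((j : ℤ) - i) * blockDet A l m n (k + 1) (i + 1) j *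
          blockDet A l m n (k + 1) i (j + 1)) / blockDet A l m n k (i + 1) (j + 1) := by
  unfold blockDet
  rw [lambdaDet_add_two, eraseFF_block, eraseLL_block, eraseFL_block, eraseLF_block, eraseLL_block]
  unfold shift unshift
  push_cast
  ring_nf

/-- In a border row or column the prescribed corner sums reduce the second difference to a step `s`,
or to `1 - s`, with `s ∈ {0, 1}`; neither is negative. -/
theorem IsASM.interior_of_eq_neg_one {n : ℕ} {B : Matrix (Fin n) (Fin n) SignType} (hB : IsASM B)
    {i j : Fin n} (h : B i j = -1) :
    0 < (i : ℕ) ∧ (i : ℕ) + 1 < n ∧ 0 < (j : ℕ) ∧ (j : ℕ) + 1 < n := by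
  have hc := (mem_cornerSums.1 hB.cornerSum_mem).1
  have e := cell_cornerSum B i.2 j.2
  rw [entry_coe, coe_signType_eq_neg_one.2 h, cell] at e
  generalize cornerSum B = c at *
  obtain ⟨i, hi⟩ := i
  obtain ⟨j, hj⟩ := j
  dsimp only at *
  have r0 := hc.row i hi.le j hj
  have r1 := hc.row (i + 1) hi j hj
  have c0 := hc.col i hi j hj.le
  have c1 := hc.col i hi (j + 1) hj
  refine ⟨?_, ?_, ?_, ?_⟩ <;> by_contra hcon
  · obtain rfl : i = 0 := by omega
    rw [hc.top j hj.le, hc.top (j + 1) hj] at e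
    omega
  · obtain rfl : n = i + 1 := by omega
    rw [hc.bottom j hj.le, hc.bottom (j + 1) hj] at e
    push_cast at e
    omega
  · obtain rfl : j = 0 := by omega
    rw [hc.left i hi.le, hc.left (i + 1) hi] at e
    omega
  · obtain rfl : n = j + 1 := by omega
    rw [hc.right i hi.le, hc.right (i + 1) hi] at e
    push_cast at e
    omega

/-- The interior entry of a `3 × 3` block is itself a denominator. In size at least 4, each interior
entry stays interior in one of the four minors: the first row is erased if `i ≥ 2` and the last one
otherwise, and similarly for columns. -/
theorem IsDefined.interior_ne_zero {K : Type*} [Field K] : ∀ (n : ℕ)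
    {A : Matrix (Fin n) (Fin n) K} {l m : ℤ → K}, IsDefined n A l m → ∀ i j : Fin n,
    0 < (i : ℕ) → (i : ℕ) + 1 < n → 0 < (j : ℕ) → (j : ℕ) + 1 < n → A i j ≠ 0
  | 0, _, _, _, _, _, _, _, _, _, _ => by omega
  | 1, _, _, _, _, _, _, _, _, _, _ => by omega
  | 2, _, _, _, _, _, _, _, _, _, _ => by omega
  | 3, A, _, _, h, i, j, hi, hi', hj, hj' => by
    obtain ⟨-, -, -, -, -, h6⟩ := h
    obtain rfl : i = 1 := Fin.ext (by simp; omega)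
    obtain rfl : j = 1 := Fin.ext (by simp; omega)
    exact h6
  | n + 4, A, _, _, h, ⟨i, _⟩, ⟨j, _⟩, hi, hi', hj, hj' => by
    obtain ⟨h1, h2, h3, h4, -, -⟩ := h
    dsimp only at *
    by_cases hi2 : 2 ≤ i <;> by_cases hj2 : 2 ≤ j
    · obtain ⟨i, rfl⟩ := Nat.exists_eq_add_of_le' hi2
      obtain ⟨j, rfl⟩ := Nat.exists_eq_add_of_le' hj2
      exact IsDefined.interior_ne_zero (n + 3) h1 ⟨i + 1, by omega⟩ ⟨j + 1, by omega⟩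
        (by simp) (by simp; omega) (by simp) (by simp; omega)
    · obtain ⟨i, rfl⟩ := Nat.exists_eq_add_of_le' hi2
      exact IsDefined.interior_ne_zero (n + 3) h3 ⟨i + 1, by omega⟩ ⟨j, by omega⟩
        (by simp) (by simp; omega) hj (by simp; omega)
    · obtain ⟨j, rfl⟩ := Nat.exists_eq_add_of_le' hj2
      exact IsDefined.interior_ne_zero (n + 3) h4 ⟨i, by omega⟩ ⟨j + 1, by omega⟩
        hi (by simp; omega) (by simp) (by simp; omega)
    · exact IsDefined.interior_ne_zero (n + 3) h2 ⟨i, by omega⟩ ⟨j, by omega⟩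
        hi (by simp; omega) hj (by simp; omega)

/-! ### The identity for indeterminates and its specialization. -/

section Generic

variable (K : Type*) [Field K] (n : ℕ)

theorem var_ne_zero (a : Vars n) : var K n a ≠ 0 :=
  (HasValueAt.var (x := fun _ => (1 : K)) a).ne_zero one_ne_zero

variable {K n} in
theorem hasValueAt_genLambda (A : Matrix (Fin n) (Fin n) K) (l m : ℤ → K) (a : ℤ) :
    HasValueAt (genLambda K n a) (point A l m) (l a) := HasValueAt.var _

variable {K n} in
theorem hasValueAt_genMu (A : Matrix (Fin n) (Fin n) K) (l m : ℤ → K) (a : ℤ) :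
    HasValueAt (genMu K n a) (point A l m) (m a) := HasValueAt.var _

variable {K n} in
theorem hasValueAt_genMatrix (A : Matrix (Fin n) (Fin n) K) (l m : ℤ → K) (i j : Fin n) :
    HasValueAt (genMatrix K n i j) (point A l m) (A i j) := HasValueAt.var _

variable {K n} in
theorem hasValueAt_lambdaDet_gen {A : Matrix (Fin n) (Fin n) K} {l m : ℤ → K}
    (h : IsDefined n A l m) : IsDefined n (genMatrix K n) (genLambda K n) (genMu K n) ∧
      HasValueAt (lambdaDet n (genMatrix K n) (genLambda K n) (genMu K n)) (point A l m)
        (lambdaDet n A l m) :=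
  IsDefined.hasValueAt_lambdaDet n (hasValueAt_genMatrix A l m) (hasValueAt_genLambda A l m)
    (hasValueAt_genMu A l m) h

theorem isDefined_gen : IsDefined n (genMatrix K n) (genLambda K n) (genMu K n) :=
  (hasValueAt_lambdaDet_gen (isDefined_one K n).1).1

theorem asmSum_zero {L : Type*} [Field L] (A : Matrix (Fin 0) (Fin 0) L) (l m : ℤ → L) :
    asmSum A l m = 1 := by
  have : Finset.univ.filter (IsASM (n := 0)) = Finset.univ :=
    filter_true_of_mem fun B _ => by simp [IsASM]
  have hcard : Fintype.card (Matrix (Fin 0) (Fin 0) SignType) = 1 :=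
    Fintype.card_eq_one_iff.2 ⟨0, fun _ => Subsingleton.elim _ _⟩
  rw [asmSum, this]
  simp [hcard]

theorem lambdaDet_gen : lambdaDet n (genMatrix K n) (genLambda K n) (genMu K n) =
    asmSum (genMatrix K n) (genLambda K n) (genMu K n) := by
  rcases n with _ | n
  · rw [asmSum_zero]
    rfl
  -- The value `1` outside the square keeps blocks that leave it nonzero: the recurrence is used
  -- with nonvanishing at all positions.
  let A : ℕ → ℕ → RatFun K (n + 1) := fun i j =>
    if h : i < n + 1 ∧ j < n + 1 then genMatrix K (n + 1) ⟨i, h.1⟩ ⟨j, h.2⟩ else 1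
  let l := genLambda K (n + 1)
  let m := genMu K (n + 1)
  have hA (i j : Fin (n + 1)) : A i j = genMatrix K (n + 1) i j := dif_pos ⟨i.2, j.2⟩
  let x : Vars (n + 1) → K := point (fun _ _ => 1) (fun _ => 0) (fun _ => 1)
  have hAx (i j : ℕ) : HasValueAt (A i j) x 1 := by
    by_cases h : i < n + 1 ∧ j < n + 1
    · simp only [A, dif_pos h]
      exact HasValueAt.var _
    · simp only [A, dif_neg h]
      exact HasValueAt.one
  -- A rational function with value `1` at the point `x` is nonzero.
  have hT (k i j : ℕ) : blockDet A l m (n + 1) k i j ≠ 0 := by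
    refine (IsDefined.hasValueAt_lambdaDet (x := x) k (fun _ _ => hAx _ _)
      (fun _ => hasValueAt_genLambda _ _ _ _) (fun _ => hasValueAt_genMu _ _ _ _)
      (isDefined_one K k).1).2.ne_zero ?_
    exact (isDefined_one K k).2.trans_ne one_ne_zero
  have main := condensation_eq_sum_cornerSums n (blockDet A l m (n + 1)) l m hT
    (fun _ => var_ne_zero K _ _) (fun _ => var_ne_zero K _ _) (fun _ _ => rfl) (by
      intro k N i j hk
      rw [blockDet_add_two, div_mul_cancel₀ _ (hT _ _ _)]
      have : (i : ℤ) + j + k + 2 - (n + 1 : ℕ) = i + j - N := by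
        rw [← hk]; push_cast; ring
      rw [this]
      ring)
  rw [asmSum_eq_sum_cornerSums _ A hA]
  have e : lambdaDet (n + 1) (genMatrix K (n + 1)) l m = blockDet A l m (n + 1) (n + 1) 0 0 := by
    unfold blockDet
    congr 1
    · funext i j
      simp [block, hA]
    · simp
    · simp
  refine e.trans (main.trans (sum_congr rfl fun c _ => prod_congr rfl fun i _ =>
    prod_congr rfl fun j _ => ?_))
  have e1 : blockDet A l m (n + 1) 1 i j = A i j := rfl
  have e2 : (i : ℤ) + j - (n + 1 : ℕ) + 1 = i + j - n := by push_cast; ring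
  rw [e1, e2]

variable {K n}

/-- Only the exponents `-1` require a nonzero entry, and they occur away from the border. -/
theorem hasValueAt_asmSum_gen (A : Matrix (Fin n) (Fin n) K) (l m : ℤ → K)
    (hA : ∀ i j : Fin n, 0 < (i : ℕ) → (i : ℕ) + 1 < n → 0 < (j : ℕ) → (j : ℕ) + 1 < n →
      A i j ≠ 0) :
    HasValueAt (asmSum (genMatrix K n) (genLambda K n) (genMu K n)) (point A l m)
      (asmSum A l m) := by
  have hl := hasValueAt_genLambda A l m
  have hm := hasValueAt_genMu A l m
  refine HasValueAt.sum fun B hB => (HasValueAt.prod fun a _ => ?_).mul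
    (HasValueAt.prod fun i _ => HasValueAt.prod fun j _ => ?_)
  · exact ((hl a).pow _).mul ((hm a).pow _)
  · refine ((hasValueAt_genMatrix A l m i j).zpow_sign _ fun h => ?_).mul (((hl _).add (hm _)).pow _)
    obtain ⟨h1, h2, h3, h4⟩ := (mem_filter.1 hB).2.interior_of_eq_neg_one h
    exact hA i j h1 h2 h3 h4

end Generic

end LambdaDet

theorem mainTheorem2 {K : Type*} [Field K] (n : ℕ) :
    -- the formula holds whenever the recursive definition makes sense
    (∀ (A : Matrix (Fin n) (Fin n) K) (l m : ℤ → K), LambdaDet.IsDefined n A l m →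
      LambdaDet.lambdaDet n A l m = LambdaDet.asmSum A l m) ∧
    -- the recursive definition makes sense for indeterminate entries and parameters, and the
    -- formula is an identity of rational functions
    (LambdaDet.IsDefined n (LambdaDet.genMatrix K n) (LambdaDet.genLambda K n)
        (LambdaDet.genMu K n) ∧
      LambdaDet.lambdaDet n (LambdaDet.genMatrix K n) (LambdaDet.genLambda K n)
        (LambdaDet.genMu K n) =
      LambdaDet.asmSum (LambdaDet.genMatrix K n) (LambdaDet.genLambda K n)
        (LambdaDet.genMu K n)) ∧
    -- that rational function is regular, with the value given by the formula, at every matrix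
    -- whose entries away from the border do not vanish
    (∀ (A : Matrix (Fin n) (Fin n) K) (l m : ℤ → K),
      (∀ i j : Fin n, 0 < (i : ℕ) → (i : ℕ) + 1 < n → 0 < (j : ℕ) → (j : ℕ) + 1 < n →
        A i j ≠ 0) →
      LambdaDet.HasValueAt
        (LambdaDet.lambdaDet n (LambdaDet.genMatrix K n) (LambdaDet.genLambda K n)
          (LambdaDet.genMu K n))
        (LambdaDet.point A l m) (LambdaDet.asmSum A l m)) := by
  have h3 (A : Matrix (Fin n) (Fin n) K) (l m : ℤ → K)
      (hA : ∀ i j : Fin n, 0 < (i : ℕ) → (i : ℕ) + 1 < n → 0 < (j : ℕ) → (j : ℕ) + 1 < n →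
        A i j ≠ 0) :
      LambdaDet.HasValueAt
        (LambdaDet.lambdaDet n (LambdaDet.genMatrix K n) (LambdaDet.genLambda K n)
          (LambdaDet.genMu K n))
        (LambdaDet.point A l m) (LambdaDet.asmSum A l m) := by
    rw [LambdaDet.lambdaDet_gen]
    exact LambdaDet.hasValueAt_asmSum_gen A l m hA
  refine ⟨fun A l m h => ?_, ⟨LambdaDet.isDefined_gen K n, LambdaDet.lambdaDet_gen K n⟩, h3⟩
  -- The recursion and the formula both give the value of the generic determinant at the same point.
  exact (LambdaDet.hasValueAt_lambdaDet_gen h).2.unique (h3 A l m (h.interior_ne_zero n))
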